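/- **Theorem (query lower bound for log-concave sampling in dimension two).** For $\kappa\ge 1$ let $\mathcal V_\kappa$ be the class of twice continuously differentiable functions $V:\mathbb R^2\to\mathbb R$ that are $1$-strongly convex, $\kappa$-smooth (i.e. $\|\nabla V(x)-\nabla V(y)\|\le\kappa\|x-y\|$ for all $x,y$) and minimized at $0$. For $V\in\mathcal V_\kappa$ let $\pi_V$ be the probability measure on $\mathbb R^2$ with density proportional to $\exp(-V)$. Consider randomized adaptive algorithms that access $V$ only through an oracle: the algorithm draws a random seed that does not depend on $V$; each query point $x_i\in\mathbb R^2$ is a function of the seed and of the earlier queries and answers; after $n$ queries the algorithm outputs a point $X\in\mathbb R^2$ that is a function of the seed and of all queries and answers. The *first-order oracle* answers a query $x$ by $(V(x),\nabla V(x))$. The *extended oracle at scale $\delta>0$* answers a query $x$ by the values of $V$ at all points of the closed ball of radius $\delta$ around $x$. The algorithm *samples from the class $\mathcal V_\kappa$ with accuracy $\varepsilon$* if for every $V\in\mathcal V_\kappa$ the law of its output $X$ satisfies $\sup_{S}|\Pr(X\in S)-\pi_V(S)|\le\varepsilon$, the supremum being over all Borel sets $S\subseteq\mathbb R^2$ (total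 variation distance). There are universal constants $\varepsilon_0>0$, $c>0$, $\kappa_0>1$ and $C>0$ such that for every $\kappa\ge\kappa_0$ and every $n\in\mathbb N$: 1. every algorithm that samples from the class $\mathcal V_\kappa$ with accuracy $\varepsilon_0$ using $n$ queries to the first-order oracle satisfies $n\ge c\log\kappa$; 2. every algorithm that samples from the class $\mathcal V_\kappa$ with accuracy $\varepsilon_0$ using $n$ queries to the extended oracle at scale $\delta=\kappa^{-C}$ satisfies $n\ge c\log\kappa$. -/

import Mathlib

universe u

open MeasureTheory Set

noncomputable section

namespace LogConcaveSampling

/-- The Euclidean plane. -/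
abbrev Plane : Type := EuclideanSpace ℝ (Fin 2)

/-- The class of potentials on the plane: twice continuously differentiable, `1`-strongly convex,
`κ`-smooth (the gradient is `κ`-Lipschitz), and minimized at the origin. -/
structure IsPotential (κ : ℝ) (V : Plane → ℝ) : Prop where
  contDiff : ContDiff ℝ 2 V
  strongConvex : StrongConvexOn univ 1 V
  smooth : ∀ x y : Plane, ‖gradient V x - gradient V y‖ ≤ κ * ‖x - y‖
  isMin : ∀ x : Plane, V 0 ≤ V x

/-- The measure `π ∝ exp (-V)`: density `exp (-V x) / ∫ exp (-V)` with respect to Lebesgue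
measure. -/
def gibbs (V : Plane → ℝ) : Measure Plane :=
  (volume : Measure Plane).tilted (fun x => -V x)

/-- The total variation distance `sup_S |μ S - ν S|` over measurable sets `S`
(used for probability measures). -/
def tvDist {α : Type*} [MeasurableSpace α] (μ ν : Measure α) : ℝ :=
  ⨆ S : {S : Set α // MeasurableSet S}, |μ.real S.1 - ν.real S.1|

/-- The first-order oracle: a query `x` to the potential `V` is answered by `(V x, ∇ V x)`. -/
def firstOrderOracle (V : Plane → ℝ) (x : Plane) : ℝ × Plane :=
  (V x, gradient V x)

/-- The extended oracle at scale `δ`: a query `x` to the potential `V` is answered by all the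
values of `V` on the closed ball of radius `δ` around `x`, listed as the function
`z ↦ V (x + z)` for `‖z‖ ≤ δ`. -/
def extendedOracle (δ : ℝ) (V : Plane → ℝ) (x : Plane) : Metric.closedBall (0 : Plane) δ → ℝ :=
  fun z => V (x + z)

/-- A randomized adaptive algorithm that receives oracle answers in `R`. It draws a random seed,
which does not depend on the potential. Each query, and finally the output, is an arbitrary
function of the seed and of the list of earlier queries with their answers.
A deterministic algorithm is one that ignores its seed. -/
structure SamplingAlgorithm (R : Type) where
  /-- the space of random seeds -/
  Seed : Type u
  [measurableSpace : MeasurableSpace Seed]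
  /-- the law of the random seed -/
  law : Measure Seed
  [isProbabilityMeasure : IsProbabilityMeasure law]
  /-- the next query -/
  query : Seed → List (Plane × R) → Plane
  /-- the point returned after the last query -/
  output : Seed → List (Plane × R) → Plane

namespace SamplingAlgorithm

attribute [instance] SamplingAlgorithm.measurableSpace SamplingAlgorithm.isProbabilityMeasure

variable {R : Type}

/-- The list of the first `n` queries with their answers, in order, when the algorithm runs with
seed `ζ` and the oracle answers a query `x` by `respond x`. -/
def transcript (A : SamplingAlgorithm.{u} R) (respond : Plane → R) (ζ : A.Seed) :
    ℕ → List (Plane × R)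
  | 0 => []
  | n + 1 =>
    A.transcript respond ζ n ++
      [(A.query ζ (A.transcript respond ζ n), respond (A.query ζ (A.transcript respond ζ n)))]

/-- The point returned after `n` queries, as a random variable on the space of seeds. -/
def sample (A : SamplingAlgorithm.{u} R) (respond : Plane → R) (n : ℕ) (ζ : A.Seed) : Plane :=
  A.output ζ (A.transcript respond ζ n)

/-- With `n` queries to the oracle, the algorithm samples from every `π ∝ exp (-V)`, for `V` a
potential in the class with parameter `κ`, to accuracy `ε` in total variation distance.
(Algorithms that stop before `n` queries are included: they ignore the remaining answers.
The only measurability required is that the output is a random variable.) -/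
def SamplesWithin (A : SamplingAlgorithm.{u} R) (oracle : (Plane → ℝ) → Plane → R)
    (κ : ℝ) (n : ℕ) (ε : ℝ) : Prop :=
  ∀ V : Plane → ℝ, IsPotential κ V →
    AEMeasurable (A.sample (oracle V) n) A.law ∧
      tvDist (A.law.map (A.sample (oracle V) n)) (gibbs V) ≤ ε

end SamplingAlgorithm

end LogConcaveSampling

end

namespace LogConcaveSampling

noncomputable section

/-! A potential of condition number `κ` can hide a direction to a precision polynomial in `κ⁻¹`,
that is, order `log κ` bits, while a local query reveals only boundedly many of them on average.

The direction. A list `b` of `J` bits selects nested intervals of slopes, shrinking by the factor `η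
/ 2`, with final centre `θ`. The hyperbola `√(1 + s²)` restricts the norm to the line `{(1, s)}`.
Subtracting from it its tangent at `θ` gives a profile with minimum `0` at `θ`. To hide `θ`, the
tangent at `0` is replaced by that at `θ` gradually: each level exchanges the tangents at two
successive centres, inside its own interval only. At every level this changes the second derivative
by `O(η)`, and at each point at most one level contributes (`abs_deriv2_tilt_le`), so the profile
stays convex however many bits there are (`isProfile_profile`). Outside `[-1, 1]` nothing changes.

The potential. The homogeneous extension of the profile is convex and vanishes on the ray through
`(1, θ)`. Composed with `ramp`, which flattens it near its singularity at the origin, multiplied by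
`A` and added to `‖z‖² / 2`, it gives a potential of smoothness `O(A²)` (`isPotential_potential`).
For `A` of order `w⁻⁴` its Gibbs measure puts at least half of its mass in the cone of aperture `w`
around the direction (`exists_half_le_gibbs_cone`). With `w` a small multiple of `(η / 2) ^ J` the
cones are disjoint, so a good sampler often identifies `b`.

The information. Values near a query of slope `s` depend on `b` only up to the first bit departing
from the path of `s` (`potential_eq_of_bitPath_ne`). For each seed this leaves at most `2 ^ n * (3 /
2) ^ J` transcripts among `2 ^ J` instances (`card_image_iterate_le`). Averaging over the seed
forces `n` to be at least of order `J`, hence of order `log κ` (`mul_two_pow_le`). -/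

lemma contDiff_one_deriv {f : ℝ → ℝ} (hf : ContDiff ℝ 2 f) : ContDiff ℝ 1 (deriv f) :=
  (contDiff_succ_iff_deriv.1 hf).2.2

/-! ### The hyperbola `√(1 + s²)` and its tangents -/

/-- The restriction of the Euclidean norm to the line `{(1, s)}`. -/
def hyp (s : ℝ) : ℝ := √(1 + s ^ 2)

lemma hyp_sq (s : ℝ) : hyp s ^ 2 = 1 + s ^ 2 := Real.sq_sqrt (by positivity)

lemma one_le_hyp (s : ℝ) : 1 ≤ hyp s := Real.one_le_sqrt.2 (by nlinarith [sq_nonneg s])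

lemma hyp_pos (s : ℝ) : 0 < hyp s := one_pos.trans_le (one_le_hyp s)

lemma contDiff_hyp {n : WithTop ℕ∞} : ContDiff ℝ n hyp :=
  ContDiff.sqrt (by fun_prop) fun s => by positivity

lemma hasDerivAt_hyp (s : ℝ) : HasDerivAt hyp (s / hyp s) s := by
  have h : HasDerivAt (fun s : ℝ => 1 + s ^ 2) (2 * s) s := by
    simpa using (hasDerivAt_pow 2 s).const_add 1
  exact (h.sqrt (by positivity)).congr_deriv (mul_div_mul_left _ _ two_ne_zero)

lemma hasDerivAt_div_hyp (s : ℝ) : HasDerivAt (fun s => s / hyp s) (1 / hyp s ^ 3) s := by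
  have hs := (hyp_pos s).ne'
  refine ((hasDerivAt_id s).div (hasDerivAt_hyp s) hs).congr_deriv ?_
  have := hyp_sq s
  simp only [id]
  field_simp
  linarith

lemma deriv_hyp : deriv hyp = fun s => s / hyp s := funext fun s => (hasDerivAt_hyp s).deriv

lemma deriv2_hyp (s : ℝ) : deriv (deriv hyp) s = 1 / hyp s ^ 3 := by
  rw [deriv_hyp, (hasDerivAt_div_hyp s).deriv]

lemma one_div_hyp_pow_le_one (s : ℝ) : 1 / hyp s ^ 3 ≤ 1 := by
  rw [div_le_one (pow_pos (hyp_pos s) 3)]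
  exact one_le_pow₀ (one_le_hyp s)

lemma one_third_le_one_div_hyp_pow {s : ℝ} (hs : |s| ≤ 1) : 1 / 3 ≤ 1 / hyp s ^ 3 := by
  have h1 : hyp s ^ 2 ≤ 2 := by
    rw [hyp_sq]; nlinarith [(sq_le_one_iff_abs_le_one s).2 hs]
  have h2 : hyp s ≤ 3 / 2 := by nlinarith [one_le_hyp s]
  refine one_div_le_one_div_of_le (pow_pos (hyp_pos s) 3) ?_
  nlinarith [one_le_hyp s]

lemma abs_div_hyp_sub_le (a b : ℝ) : |a / hyp a - b / hyp b| ≤ |a - b| := by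
  have h := Convex.norm_image_sub_le_of_norm_hasDerivWithin_le (f := fun s => s / hyp s)
    (f' := fun s => 1 / hyp s ^ 3) (s := univ) (C := 1) (x := b) (y := a)
    (fun x _ => (hasDerivAt_div_hyp x).hasDerivWithinAt)
    (fun x _ => by
      rw [Real.norm_of_nonneg (div_nonneg zero_le_one (pow_nonneg (hyp_pos x).le 3))]
      exact one_div_hyp_pow_le_one x)
    convex_univ (mem_univ _) (mem_univ _)
  simpa using h

/-- The tangent line at `a` of the hyperbola. -/
def tangent (a s : ℝ) : ℝ := hyp a + a / hyp a * (s - a)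

lemma hasDerivAt_tangent (a s : ℝ) : HasDerivAt (tangent a) (a / hyp a) s := by
  have := (((hasDerivAt_id s).sub_const a).const_mul (a / hyp a)).const_add (hyp a)
  exact this.congr_deriv (mul_one _)

lemma contDiff_tangent {n : WithTop ℕ∞} (a : ℝ) : ContDiff ℝ n (tangent a) := by
  unfold tangent; fun_prop

lemma abs_hyp_sub_tangent_le (a b : ℝ) : |hyp a - tangent b a| ≤ |a - b| ^ 2 := by
  have h := Convex.norm_image_sub_le_of_norm_hasDerivWithin_le (f := fun s => hyp s - tangent b s)
    (f' := fun s => s / hyp s - b / hyp b) (s := uIcc b a) (C := |a - b|) (x := b) (y := a)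
    (fun x _ => ((hasDerivAt_hyp x).sub (hasDerivAt_tangent b x)).hasDerivWithinAt)
    (fun x hx => (abs_div_hyp_sub_le x b).trans (abs_sub_left_of_mem_uIcc hx))
    (convex_uIcc _ _) left_mem_uIcc right_mem_uIcc
  have h0 : tangent b b = hyp b := by simp [tangent]
  simpa [h0, sq] using h

/-- At `a` the tangents differ by at most `|a - b| ^ 2`, and their slopes by at most `|a - b|`. With
`|a - b| = ηR` and `|s - a| ≤ R` the difference is `O(ηR²)`, which absorbs the factor `R⁻²` from two
derivatives of a cutoff at scale `R`. -/
lemma abs_tangent_sub_le (a b s : ℝ) :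
    |tangent a s - tangent b s| ≤ |a - b| ^ 2 + |a - b| * |s - a| := by
  have h : tangent a s - tangent b s =
      (hyp a - tangent b a) + (a / hyp a - b / hyp b) * (s - a) := by
    simp only [tangent]; ring
  rw [h]
  refine (abs_add_le _ _).trans (add_le_add (abs_hyp_sub_tangent_le a b) ?_)
  rw [abs_mul]
  exact mul_le_mul_of_nonneg_right (abs_div_hyp_sub_le a b) (abs_nonneg _)

/-! ### A smooth cutoff -/

/-- A smooth function on the line, equal to `1` on `[-1/2, 1/2]` and to `0` off `[-1, 1]`. -/
def cut : ContDiffBump (0 : ℝ) := ⟨1 / 2, 1, by norm_num, by norm_num⟩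

lemma contDiff_cut {n : ℕ∞} : ContDiff ℝ n (cut : ℝ → ℝ) := cut.contDiff

lemma cut_eq_zero {u : ℝ} (hu : 1 ≤ |u|) : cut u = 0 :=
  cut.zero_of_le_dist (by simpa [cut, Real.dist_eq] using hu)

lemma cut_eq_one {u : ℝ} (hu : |u| ≤ 1 / 2) : cut u = 1 :=
  cut.one_of_mem_closedBall (by simpa [cut, Real.dist_eq] using hu)

lemma exists_bound_deriv_cut :
    ∃ K : ℝ, 1 ≤ K ∧ ∀ u, |deriv cut u| ≤ K ∧ |deriv (deriv cut) u| ≤ K := by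
  have hc : ContDiff ℝ 2 (cut : ℝ → ℝ) := contDiff_cut (n := 2)
  have hd : ContDiff ℝ 1 (deriv (cut : ℝ → ℝ)) := contDiff_one_deriv hc
  have hs : HasCompactSupport (cut : ℝ → ℝ) := cut.hasCompactSupport
  obtain ⟨K₁, h₁⟩ := hs.deriv.exists_bound_of_continuous hd.continuous
  obtain ⟨K₂, h₂⟩ := hs.deriv.deriv.exists_bound_of_continuous (hd.continuous_deriv le_rfl)
  exact ⟨max 1 (max K₁ K₂), le_max_left _ _, fun u =>
    ⟨(h₁ u).trans ((le_max_left _ _).trans (le_max_right _ _)),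
      (h₂ u).trans ((le_max_right _ _).trans (le_max_right _ _))⟩⟩

/-! ### The family of profiles -/

/-- The sign attached to a bit. -/
def bitSign (b : Bool) : ℝ := if b then 1 else -1

lemma abs_bitSign (b : Bool) : |bitSign b| = 1 := by cases b <;> simp [bitSign]

/-- The centre of the dyadic-like interval with radius `R * (η/2) ^ bs.length` reached from the
interval of radius `R` around `a` by following the bits `bs`. -/
def center (η : ℝ) : List Bool → ℝ → ℝ → ℝ
  | [], a, _ => a
  | b :: bs, a, R => center η bs (a + bitSign b * (η * R)) (η / 2 * R)

/-- The perturbation that successively replaces the tangent of the hyperbola at `a` by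
the tangents at the centres of the intervals met when following the bits. -/
def tilt (η : ℝ) : List Bool → ℝ → ℝ → ℝ → ℝ
  | [], _, _, _ => 0
  | b :: bs, a, R, s =>
    (tangent a s - tangent (a + bitSign b * (η * R)) s) * cut ((s - a) / R) +
      tilt η bs (a + bitSign b * (η * R)) (η / 2 * R) s

section

variable {η : ℝ} (h0 : 0 < η) (h1 : η ≤ 1 / 4)
include h0 h1

lemma abs_center_sub_le (bs : List Bool) (a : ℝ) {R : ℝ} (hR : 0 < R) :
    |center η bs a R - a| ≤ R := by
  induction bs generalizing a R with
  | nil => simpa [center] using hR.le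
  | cons b bs ih =>
    have h := ih (a + bitSign b * (η * R)) (R := η / 2 * R) (by positivity)
    have hb : |bitSign b * (η * R)| = η * R := by
      rw [abs_mul, abs_bitSign, one_mul, abs_of_pos (by positivity)]
    rw [center]
    have := abs_add_le (center η bs (a + bitSign b * (η * R)) (η / 2 * R) -
      (a + bitSign b * (η * R))) (bitSign b * (η * R))
    rw [hb] at this
    rw [show ∀ c x : ℝ, c - a = c - (a + x) + x by intros; ring]
    nlinarith

/-- The intervals are nested, because `ηR + (η / 2)R ≤ R`, so every cutoff in the sum vanishes
outside the first interval. -/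
lemma tilt_eq_zero (bs : List Bool) (a : ℝ) {R s : ℝ} (hR : 0 < R) (hs : R ≤ |s - a|) :
    tilt η bs a R s = 0 := by
  induction bs generalizing a R with
  | nil => rfl
  | cons b bs ih =>
    have hb : |bitSign b * (η * R)| = η * R := by
      rw [abs_mul, abs_bitSign, one_mul, abs_of_pos (by positivity)]
    rw [tilt, cut_eq_zero, ih _ (by positivity), mul_zero, add_zero]
    · have := abs_sub_abs_le_abs_sub (s - a) (bitSign b * (η * R))
      rw [hb, sub_sub] at this
      nlinarith
    · rwa [abs_div, abs_of_pos hR, one_le_div hR]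

omit h0 h1 in
lemma contDiff_tilt (bs : List Bool) (a R : ℝ) : ContDiff ℝ 2 (tilt η bs a R) := by
  induction bs generalizing a R with
  | nil => exact contDiff_const
  | cons b bs ih =>
    have hc : ContDiff ℝ 2 fun s => cut ((s - a) / R) :=
      (contDiff_cut (n := 2)).comp (by fun_prop : ContDiff ℝ 2 fun s : ℝ => (s - a) / R)
    exact (((contDiff_tangent a).sub (contDiff_tangent _)).mul hc).add (ih _ _)

omit h0 h1 in
lemma deriv2_tilt_cons (b : Bool) (bs : List Bool) (a R s : ℝ) :
    deriv (deriv (tilt η (b :: bs) a R)) s =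
      deriv (deriv fun s => (tangent a s - tangent (a + bitSign b * (η * R)) s) *
        cut ((s - a) / R)) s + deriv (deriv (tilt η bs (a + bitSign b * (η * R)) (η / 2 * R))) s := by
  have hc : ContDiff ℝ 2 fun s => cut ((s - a) / R) :=
    (contDiff_cut (n := 2)).comp (by fun_prop : ContDiff ℝ 2 fun s : ℝ => (s - a) / R)
  have h₁ : ContDiff ℝ 2 fun s => (tangent a s - tangent (a + bitSign b * (η * R)) s) *
        cut ((s - a) / R) := ((contDiff_tangent a).sub (contDiff_tangent _)).mul hc
  have h₂ := contDiff_tilt (η := η) bs (a + bitSign b * (η * R)) (η / 2 * R)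
  have e : deriv (tilt η (b :: bs) a R) = fun s => deriv (fun s => (tangent a s -
      tangent (a + bitSign b * (η * R)) s) * cut ((s - a) / R)) s +
      deriv (tilt η bs (a + bitSign b * (η * R)) (η / 2 * R)) s := by
    funext s
    exact deriv_fun_add (h₁.differentiable two_ne_zero s) (h₂.differentiable two_ne_zero s)
  have h₁' := contDiff_one_deriv h₁
  have h₂' := contDiff_one_deriv h₂
  rw [e]
  exact deriv_fun_add (h₁'.differentiable one_ne_zero s) (h₂'.differentiable one_ne_zero s)

/-- Close to the centre of the plateau of the cutoff, the first tilt is affine. -/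
lemma eventuallyEq_first_tilt (b : Bool) (a : ℝ) {R s : ℝ} (hR : 0 < R)
    (hs : |s - (a + bitSign b * (η * R))| ≤ η / 2 * R) :
    (fun s => (tangent a s - tangent (a + bitSign b * (η * R)) s) * cut ((s - a) / R)) =ᶠ[nhds s]
      fun s => tangent a s - tangent (a + bitSign b * (η * R)) s := by
  have hb : |bitSign b * (η * R)| = η * R := by
    rw [abs_mul, abs_bitSign, one_mul, abs_of_pos (by positivity)]
  have hlt : |s - a| < R / 2 := by
    have := abs_add_le (s - (a + bitSign b * (η * R))) (bitSign b * (η * R))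
    rw [hb, show s - (a + bitSign b * (η * R)) + bitSign b * (η * R) = s - a by ring] at this
    nlinarith
  have hc : Continuous fun s : ℝ => |s - a| := by fun_prop
  filter_upwards [hc.continuousAt.eventually (gt_mem_nhds hlt)] with t ht
  rw [cut_eq_one, mul_one]
  rw [abs_div, abs_of_pos hR, div_le_iff₀ hR]
  linarith

/-- The bound does not depend on the scale `R`. In the second derivative of affine function times
cutoff, the cross term occurs twice, each time at most `(ηR)(K / R)`, and the last term is at most
`(2ηR²)(K / R²)`. -/
lemma abs_deriv2_first_tilt_le {K : ℝ}
    (hK : ∀ u, |deriv cut u| ≤ K ∧ |deriv (deriv cut) u| ≤ K)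
    (b : Bool) (a s : ℝ) {R : ℝ} (hR : 0 < R) :
    |deriv (deriv fun s => (tangent a s - tangent (a + bitSign b * (η * R)) s) *
        cut ((s - a) / R)) s| ≤ 4 * η * K := by
  set a' := a + bitSign b * (η * R) with ha'
  have hK0 : 0 ≤ K := (abs_nonneg _).trans (hK 0).1
  have hb : |a - a'| = η * R := by
    rw [ha', sub_add_cancel_left, abs_neg, abs_mul, abs_bitSign, one_mul,
      abs_of_pos (by positivity)]
  by_cases hs : R < |s - a|
  · have hc : Continuous fun s : ℝ => |s - a| := by fun_prop
    have e : (fun s => (tangent a s - tangent a' s) * cut ((s - a) / R)) =ᶠ[nhds s]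
        fun _ => (0 : ℝ) := by
      filter_upwards [hc.continuousAt.eventually (lt_mem_nhds hs)] with t ht
      rw [cut_eq_zero, mul_zero]
      rw [abs_div, abs_of_pos hR, one_le_div hR]
      exact ht.le
    rw [e.deriv.deriv_eq]
    simp only [deriv_const', abs_zero]
    positivity
  · push Not at hs
    have hcd : ContDiff ℝ 2 (cut : ℝ → ℝ) := contDiff_cut (n := 2)
    have hcd' : ContDiff ℝ 1 (deriv (cut : ℝ → ℝ)) := contDiff_one_deriv hcd
    have hlin : ∀ s : ℝ, HasDerivAt (fun s => (s - a) / R) (1 / R) s := fun s =>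
      ((hasDerivAt_id s).sub_const a).div_const R
    have hc1 : ∀ s : ℝ, HasDerivAt (fun s => cut ((s - a) / R))
        (deriv cut ((s - a) / R) * (1 / R)) s := fun s =>
      ((hcd.differentiable two_ne_zero _).hasDerivAt).comp s (hlin s)
    have hc2 : ∀ s : ℝ, HasDerivAt (fun s => deriv cut ((s - a) / R))
        (deriv (deriv cut) ((s - a) / R) * (1 / R)) s := fun s =>
      ((hcd'.differentiable one_ne_zero _).hasDerivAt).comp s (hlin s)
    set β := a / hyp a - a' / hyp a' with hβ
    have ht : ∀ s : ℝ, HasDerivAt (fun s => tangent a s - tangent a' s) β s := fun s =>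
      (hasDerivAt_tangent a s).sub (hasDerivAt_tangent a' s)
    have e1 : deriv (fun s => (tangent a s - tangent a' s) * cut ((s - a) / R)) = fun s =>
        β * cut ((s - a) / R) + (tangent a s - tangent a' s) *
          (deriv cut ((s - a) / R) * (1 / R)) :=
      funext fun s => ((ht s).mul (hc1 s)).deriv
    have e2 := (((hc1 s).const_mul β).add ((ht s).mul ((hc2 s).mul_const (1 / R)))).deriv
    rw [e1]
    refine (congrArg abs e2).trans_le ?_
    have hβ' : |β| ≤ η * R := (abs_div_hyp_sub_le a a').trans hb.le
    have hT : |tangent a s - tangent a' s| ≤ 2 * η * R ^ 2 := by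
      refine (abs_tangent_sub_le a a' s).trans ?_
      rw [hb]
      have : η * R * |s - a| ≤ η * R * R := mul_le_mul_of_nonneg_left hs (by positivity)
      nlinarith [mul_pos h0 (pow_pos hR 2)]
    obtain ⟨k1, k2⟩ := hK ((s - a) / R)
    have b1 : |β * (deriv cut ((s - a) / R) * (1 / R))| ≤ η * K := by
      rw [abs_mul, abs_mul, abs_of_pos (by positivity : 0 < 1 / R)]
      calc |β| * (|deriv cut ((s - a) / R)| * (1 / R)) ≤ (η * R) * (K * (1 / R)) := by gcongr
        _ = η * K := by field_simp
    have b2 : |(tangent a s - tangent a' s) *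
        (deriv (deriv cut) ((s - a) / R) * (1 / R) * (1 / R))| ≤ 2 * η * K := by
      rw [abs_mul, abs_mul, abs_mul, abs_of_pos (by positivity : 0 < 1 / R)]
      calc _ ≤ (2 * η * R ^ 2) * (K * (1 / R) * (1 / R)) := by gcongr
        _ = 2 * η * K := by field_simp
    refine (abs_add_le _ _).trans ?_
    have := abs_add_le (β * (deriv cut ((s - a) / R) * (1 / R))) ((tangent a s - tangent a' s) *
        (deriv (deriv cut) ((s - a) / R) * (1 / R) * (1 / R)))
    linarith

/-- The contributions of the levels do not add up: where the later tilts live, the current one is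
affine, and elsewhere the later ones vanish. -/
lemma abs_deriv2_tilt_le {K : ℝ} (hK : ∀ u, |deriv cut u| ≤ K ∧ |deriv (deriv cut) u| ≤ K)
    (bs : List Bool) (a s : ℝ) {R : ℝ} (hR : 0 < R) :
    |deriv (deriv (tilt η bs a R)) s| ≤ 4 * η * K := by
  have hK0 : 0 ≤ K := (abs_nonneg _).trans (hK 0).1
  induction bs generalizing a R with
  | nil =>
    have : tilt η [] a R = fun _ => 0 := rfl
    rw [this]
    simp only [deriv_const', abs_zero]
    positivity
  | cons b bs ih =>
    rw [deriv2_tilt_cons]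
    by_cases hs : |s - (a + bitSign b * (η * R))| ≤ η / 2 * R
    · rw [(eventuallyEq_first_tilt h0 h1 b a hR hs).deriv.deriv_eq]
      have e : deriv (fun s => tangent a s - tangent (a + bitSign b * (η * R)) s) = fun _ =>
          a / hyp a - (a + bitSign b * (η * R)) / hyp (a + bitSign b * (η * R)) :=
        funext fun s => ((hasDerivAt_tangent a s).sub (hasDerivAt_tangent _ s)).deriv
      rw [e, deriv_const, zero_add]
      exact ih _ (by positivity)
    · push Not at hs
      have hc : Continuous fun t : ℝ => |t - (a + bitSign b * (η * R))| := by fun_prop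
      have e : tilt η bs (a + bitSign b * (η * R)) (η / 2 * R) =ᶠ[nhds s] fun _ => 0 := by
        filter_upwards [hc.continuousAt.eventually (lt_mem_nhds hs)] with t ht
        exact tilt_eq_zero h0 h1 bs _ (by positivity) ht.le
      rw [e.deriv.deriv_eq]
      simp only [deriv_const', add_zero]
      exact abs_deriv2_first_tilt_le h0 h1 hK b a s hR

/-- Close to the last centre, the tilt replaces the tangent at `a` by the tangent at that
centre. -/
lemma eventuallyEq_tilt (bs : List Bool) (a : ℝ) {R : ℝ} (hR : 0 < R) :
    tilt η bs a R =ᶠ[nhds (center η bs a R)]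
      fun s => tangent a s - tangent (center η bs a R) s := by
  induction bs generalizing a R with
  | nil => exact Filter.Eventually.of_forall fun s => by simp [tilt, center]
  | cons b bs ih =>
    have hp : 0 < η / 2 * R := by positivity
    have hc := abs_center_sub_le h0 h1 bs (a + bitSign b * (η * R)) hp
    have h₁ := eventuallyEq_first_tilt h0 h1 b a hR hc
    rw [center]
    filter_upwards [h₁, ih (a + bitSign b * (η * R)) hp] with s e₁ e₂
    rw [tilt, e₁, e₂]
    ring

/-- At the first differing bit the next centres are `2ηR` apart, and each final centre stays within
`(η / 2)R` of its own, which leaves a gap of at least `ηR`. -/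
lemma center_separated (bs bs' : List Bool) (hl : bs.length = bs'.length) (hne : bs ≠ bs')
    (a : ℝ) {R : ℝ} (hR : 0 < R) :
    2 * ((η / 2) ^ bs.length * R) ≤ |center η bs a R - center η bs' a R| := by
  induction bs generalizing bs' a R with
  | nil =>
    cases bs' with
    | nil => exact absurd rfl hne
    | cons => simp at hl
  | cons b bs ih =>
    cases bs' with
    | nil => simp at hl
    | cons b' bs' =>
      have hp : 0 < η / 2 * R := by positivity
      simp only [List.length_cons, add_left_inj] at hl
      rw [center, center, List.length_cons, pow_succ, mul_assoc]
      by_cases hb : b = b'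
      · subst hb
        exact ih bs' hl (fun h => hne (by rw [h])) _ hp
      · have c := abs_le.1 (abs_center_sub_le h0 h1 bs (a + bitSign b * (η * R)) hp)
        have c' := abs_le.1 (abs_center_sub_le h0 h1 bs' (a + bitSign b' * (η * R)) hp)
        have hle : (η / 2) ^ bs.length * (η / 2 * R) ≤ η / 2 * R :=
          mul_le_of_le_one_left hp.le (pow_le_one₀ (by positivity) (by linarith))
        cases b <;> cases b' <;> simp [bitSign] at hb c c' ⊢
        · rw [abs_sub_comm]
          exact le_trans (by linarith) (le_abs_self _)
        · exact le_trans (by linarith) (le_abs_self _)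

end

/-- The bits followed by the abscissa `s`: at each interval, the side of the centre where `s`
lies. -/
def bitPath (η s : ℝ) : ℕ → ℝ → ℝ → Bool
  | 0, a, _ => decide (a ≤ s)
  | n + 1, a, R => bitPath η s n (a + bitSign (decide (a ≤ s)) * (η * R)) (η / 2 * R)

/-- The perturbation at abscissas close to `s` depends on the bits only up to the first bit that
departs from the path of `s`. -/
lemma tilt_eq_of_bitPath_ne {η : ℝ} (h0 : 0 < η) (h1 : η ≤ 1 / 4) (s s' : ℝ)
    (p : List Bool) (x : Bool) (t t' : List Bool)
    (a : ℝ) {R : ℝ} (hR : 0 < R)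
    (hs : |s' - s| ≤ (η / 2) ^ (p.length + 1 + t.length) * R)
    (hx : x ≠ bitPath η s p.length a R) :
    tilt η (p ++ x :: t) a R s' = tilt η (p ++ x :: t') a R s' := by
  have hρ : 0 ≤ η / 2 := by positivity
  have hρ1 : η / 2 ≤ 1 := by linarith
  -- departing at once from the path of `s` puts `s'` outside of the next interval
  have key : ∀ (x : Bool) (a R : ℝ), 0 < R → |s' - s| ≤ η / 2 * R → x ≠ decide (a ≤ s) →
      η / 2 * R ≤ |s' - (a + bitSign x * (η * R))| := by
    intro x a R hR hs hx
    rw [abs_le] at hs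
    cases x
    · have : a ≤ s := by simpa using hx
      simp only [bitSign]
      exact le_trans (by simp; linarith) (le_abs_self _)
    · have : s < a := by simpa using hx
      simp only [bitSign]
      exact le_trans (by simp; linarith) (neg_le_abs _)
  induction p generalizing a R with
  | nil =>
    have hs' : |s' - s| ≤ η / 2 * R := by
      refine hs.trans (mul_le_mul_of_nonneg_right ?_ hR.le)
      exact pow_le_of_le_one hρ hρ1 (by simp)
    have := key x a R hR hs' hx
    simp only [List.nil_append, tilt]
    rw [tilt_eq_zero h0 h1 t _ (by positivity) this, tilt_eq_zero h0 h1 t' _ (by positivity) this]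
  | cons b p ih =>
    simp only [List.cons_append, tilt, add_right_inj]
    -- Either the path of `s` is still being followed, or an earlier bit has already left it and
    -- both remaining tilts vanish at `s'`.
    by_cases hb : b = decide (a ≤ s)
    · refine ih _ (by positivity) (hs.trans (le_of_eq ?_)) ?_
      · simp only [List.length_cons]; ring
      · rw [List.length_cons, bitPath] at hx
        rwa [hb]
    · have hs' : |s' - s| ≤ η / 2 * R := by
        refine hs.trans (mul_le_mul_of_nonneg_right ?_ hR.le)
        exact pow_le_of_le_one hρ hρ1 (by simp)
      have := key b a R hR hs' hb
      rw [tilt_eq_zero h0 h1 _ _ (by positivity) this, tilt_eq_zero h0 h1 _ _ (by positivity) this]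

/-! ### Profiles -/

/-- A strongly convex function on the line that vanishes to second order at `θ` and agrees with
`√(1 + s²) - 1` outside of `[-1, 1]`. -/
structure IsProfile (f : ℝ → ℝ) (θ : ℝ) : Prop where
  contDiff : ContDiff ℝ 2 f
  eq_hyp : ∀ s, 1 ≤ |s| → f s = hyp s - 1
  deriv2_nonneg : ∀ s, 0 ≤ deriv (deriv f) s
  deriv2_le : ∀ s, deriv (deriv f) s ≤ 2
  le_deriv2 : ∀ s, |s| ≤ 1 → 1 / 5 ≤ deriv (deriv f) s
  abs_le_one : |θ| ≤ 1
  apply_self : f θ = 0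
  deriv_self : deriv f θ = 0

/-- The member of the family of profiles encoded by a list of bits. -/
def profile (η : ℝ) (bs : List Bool) (s : ℝ) : ℝ := hyp s - 1 + tilt η bs 0 1 s

/-- On `[-1, 1]` the hyperbola has second derivative at least `1/3` and the tilt costs at most
`1/8`, leaving more than `1/5`. Since the tangent at `0` is the constant `1`, near its final centre
the profile equals the hyperbola minus its tangent there, hence the double zero. -/
lemma isProfile_profile {η K : ℝ} (h0 : 0 < η) (h1 : η ≤ 1 / 4)
    (hK : ∀ u, |deriv cut u| ≤ K ∧ |deriv (deriv cut) u| ≤ K) (hη : 4 * η * K ≤ 1 / 8)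
    (bs : List Bool) : IsProfile (profile η bs) (center η bs 0 1) := by
  have ht := contDiff_tilt (η := η) bs 0 1
  have hd1 : deriv (profile η bs) = fun s => deriv hyp s + deriv (tilt η bs 0 1) s := by
    funext s
    exact (((contDiff_hyp (n := 2)).differentiable two_ne_zero s).hasDerivAt.sub_const 1 |>.add
      (ht.differentiable two_ne_zero s).hasDerivAt).deriv
  have hd2 : ∀ s, deriv (deriv (profile η bs)) s =
      1 / hyp s ^ 3 + deriv (deriv (tilt η bs 0 1)) s := by
    intro s
    rw [hd1, ← deriv2_hyp]
    exact deriv_fun_add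
      ((contDiff_one_deriv contDiff_hyp).differentiable one_ne_zero s)
      ((contDiff_one_deriv ht).differentiable one_ne_zero s)
  have hb : ∀ s, |deriv (deriv (tilt η bs 0 1)) s| ≤ 1 / 8 := fun s =>
    (abs_deriv2_tilt_le h0 h1 hK bs 0 s one_pos).trans hη
  have hinside : ∀ s, |s| ≤ 1 → 1 / 5 ≤ deriv (deriv (profile η bs)) s := fun s hs => by
    rw [hd2]
    have := one_third_le_one_div_hyp_pow hs
    have := (abs_le.1 (hb s)).1
    linarith
  have hzero : ∀ s, 1 ≤ |s| → tilt η bs 0 1 s = 0 := fun s hs =>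
    tilt_eq_zero h0 h1 bs 0 one_pos (by simpa using hs)
  have htan : tangent 0 = fun _ => (1 : ℝ) := by funext s; simp [tangent, hyp]
  have hself := eventuallyEq_tilt h0 h1 bs 0 one_pos
  refine ⟨(contDiff_hyp.sub contDiff_const).add ht, fun s hs => ?_, fun s => ?_, fun s => ?_,
    hinside, ?_, ?_, ?_⟩
  · rw [profile, hzero s hs, add_zero]
  · rcases le_or_gt |s| 1 with hs | hs
    · exact le_trans (by norm_num) (hinside s hs)
    · have e : tilt η bs 0 1 =ᶠ[nhds s] fun _ => 0 := by
        filter_upwards [continuous_abs.continuousAt.eventually (lt_mem_nhds hs)] with t ht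
        exact hzero t ht.le
      rw [hd2, e.deriv.deriv_eq]
      simp only [deriv_const', add_zero]
      exact div_nonneg zero_le_one (pow_nonneg (hyp_pos s).le 3)
  · rw [hd2]
    have := one_div_hyp_pow_le_one s
    have := (abs_le.1 (hb s)).2
    linarith
  · simpa using abs_center_sub_le h0 h1 bs 0 one_pos
  · rw [profile, hself.eq_of_nhds, htan]
    simp [tangent]
  · simp only [hd1, hself.deriv_eq, deriv_hyp, htan]
    have : deriv (fun s => (1 : ℝ) - tangent (center η bs 0 1) s) (center η bs 0 1) =
        -(center η bs 0 1 / hyp (center η bs 0 1)) :=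
      ((hasDerivAt_tangent _ _).const_sub 1).deriv
    rw [this]
    ring

namespace IsProfile

variable {f : ℝ → ℝ} {θ : ℝ} (hf : IsProfile f θ)
include hf

lemma hasDerivAt (s : ℝ) : HasDerivAt f (deriv f s) s :=
  (hf.contDiff.differentiable two_ne_zero s).hasDerivAt

lemma hasDerivAt_deriv (s : ℝ) : HasDerivAt (deriv f) (deriv (deriv f) s) s :=
  ((contDiff_one_deriv hf.contDiff).differentiable one_ne_zero s).hasDerivAt

lemma abs_deriv_le (s : ℝ) : |deriv f s| ≤ 2 * |s - θ| := by
  have h := Convex.norm_image_sub_le_of_norm_hasDerivWithin_le (f := deriv f)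
    (f' := deriv (deriv f)) (s := univ) (C := 2) (x := θ) (y := s)
    (fun x _ => (hf.hasDerivAt_deriv x).hasDerivWithinAt)
    (fun x _ => by
      rw [Real.norm_of_nonneg (hf.deriv2_nonneg x)]
      exact hf.deriv2_le x)
    convex_univ (mem_univ _) (mem_univ _)
  simpa [hf.deriv_self] using h

lemma abs_apply_le (s : ℝ) : |f s| ≤ 2 * (s - θ) ^ 2 := by
  have h := Convex.norm_image_sub_le_of_norm_hasDerivWithin_le (f := f)
    (f' := deriv f) (s := uIcc θ s) (C := 2 * |s - θ|) (x := θ) (y := s)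
    (fun x _ => (hf.hasDerivAt x).hasDerivWithinAt)
    (fun x hx => (hf.abs_deriv_le x).trans
      (mul_le_mul_of_nonneg_left (abs_sub_left_of_mem_uIcc hx) zero_le_two))
    (convex_uIcc _ _) left_mem_uIcc right_mem_uIcc
  rw [hf.apply_self, sub_zero, Real.norm_eq_abs, Real.norm_eq_abs, mul_assoc, ← sq, sq_abs] at h
  exact h

/-- The difference with the parabola is convex on `[-1, 1]` and has a critical zero at `θ`. -/
lemma le_apply {s : ℝ} (hs : |s| ≤ 1) : 1 / 10 * (s - θ) ^ 2 ≤ f s := by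
  set g : ℝ → ℝ := fun s => f s - 1 / 10 * (s - θ) ^ 2 with hg
  have hsq : ∀ s : ℝ, HasDerivAt (fun s => 1 / 10 * (s - θ) ^ 2) (1 / 5 * (s - θ)) s := fun s =>
    ((((hasDerivAt_id s).sub_const θ).pow 2).const_mul (1 / 10)).congr_deriv
      (by simp only [id]; ring)
  have hlin : ∀ s : ℝ, HasDerivAt (fun s => 1 / 5 * (s - θ)) (1 / 5) s := fun s =>
    (((hasDerivAt_id s).sub_const θ).const_mul (1 / 5)).congr_deriv (mul_one _)
  have hg1 : ∀ s, HasDerivAt g (deriv f s - 1 / 5 * (s - θ)) s := fun s =>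
    (hf.hasDerivAt s).sub (hsq s)
  have hg2 : ∀ s, HasDerivAt (fun s => deriv f s - 1 / 5 * (s - θ))
      (deriv (deriv f) s - 1 / 5) s := fun s => (hf.hasDerivAt_deriv s).sub (hlin s)
  have hconv : ConvexOn ℝ (Icc (-1) 1) g :=
    convexOn_of_hasDerivWithinAt2_nonneg (convex_Icc _ _)
      (fun s _ => (hg1 s).continuousAt.continuousWithinAt)
      (fun s _ => (hg1 s).hasDerivWithinAt) (fun s _ => (hg2 s).hasDerivWithinAt)
      (fun s hs => by
        have := hf.le_deriv2 s (abs_le.2 (mem_Icc.1 (interior_subset hs)))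
        linarith)
  have hθ : g θ = 0 := by simp [hg, hf.apply_self]
  have hd : HasDerivAt g 0 θ := by simpa [hf.deriv_self] using hg1 θ
  have hθm : θ ∈ Icc (-1 : ℝ) 1 := abs_le.1 hf.abs_le_one
  have hsm : s ∈ Icc (-1 : ℝ) 1 := abs_le.1 hs
  suffices h : 0 ≤ g s by simpa [hg] using h
  rcases lt_trichotomy s θ with h | h | h
  · have := hconv.slope_le_of_hasDerivAt hsm hθm h hd
    rw [slope_def_field, hθ, zero_sub, div_le_iff₀ (sub_pos.2 h)] at this
    linarith
  · rw [h, hθ]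
  · have := hconv.le_slope_of_hasDerivAt hθm hsm h hd
    rw [slope_def_field, hθ, sub_zero, le_div_iff₀ (sub_pos.2 h)] at this
    linarith

end IsProfile

/-! ### A smooth ramp -/

/-- The derivative of `ramp`. -/
def rampDeriv (t : ℝ) : ℝ := ∫ u in (0 : ℝ)..t, cut (u - 2)

/-- A smooth convex function that vanishes on `(-∞, 1]` and grows linearly. -/
def ramp (t : ℝ) : ℝ := ∫ u in (0 : ℝ)..t, rampDeriv u

lemma continuous_cut_sub : Continuous fun u : ℝ => cut (u - 2) :=
  cut.continuous.comp (continuous_id.sub continuous_const)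

lemma hasDerivAt_rampDeriv (t : ℝ) : HasDerivAt rampDeriv (cut (t - 2)) t :=
  intervalIntegral.integral_hasDerivAt_right (continuous_cut_sub.intervalIntegrable _ _)
    continuous_cut_sub.aestronglyMeasurable.stronglyMeasurableAtFilter
    continuous_cut_sub.continuousAt

lemma continuous_rampDeriv : Continuous rampDeriv :=
  continuous_iff_continuousAt.2 fun t => (hasDerivAt_rampDeriv t).continuousAt

lemma hasDerivAt_ramp (t : ℝ) : HasDerivAt ramp (rampDeriv t) t :=
  intervalIntegral.integral_hasDerivAt_right (continuous_rampDeriv.intervalIntegrable _ _)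
    continuous_rampDeriv.aestronglyMeasurable.stronglyMeasurableAtFilter
    continuous_rampDeriv.continuousAt

lemma contDiff_ramp : ContDiff ℝ 2 ramp := by
  have h1 : deriv ramp = rampDeriv := funext fun t => (hasDerivAt_ramp t).deriv
  have h2 : deriv rampDeriv = fun t => cut (t - 2) := funext fun t => (hasDerivAt_rampDeriv t).deriv
  have : ContDiff ℝ 1 rampDeriv := by
    refine contDiff_one_iff_deriv.2 ⟨fun t => (hasDerivAt_rampDeriv t).differentiableAt, ?_⟩
    rw [h2]; exact continuous_cut_sub
  refine (contDiff_succ_iff_deriv (n := 1)).2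
    ⟨fun t => (hasDerivAt_ramp t).differentiableAt, by simp, ?_⟩
  rwa [h1]

lemma monotone_rampDeriv : Monotone rampDeriv :=
  monotone_of_deriv_nonneg (fun t => (hasDerivAt_rampDeriv t).differentiableAt) fun t => by
    rw [(hasDerivAt_rampDeriv t).deriv]; exact cut.nonneg

lemma rampDeriv_eq_zero {t : ℝ} (ht : t ≤ 1) : rampDeriv t = 0 := by
  rw [rampDeriv, intervalIntegral.integral_congr (g := fun _ => (0 : ℝ)) fun u hu => ?_]
  · simp
  · have hu1 : u ≤ 1 := hu.2.trans (max_le zero_le_one ht)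
    exact cut_eq_zero (by rw [abs_of_nonpos (by linarith)]; linarith)

lemma rampDeriv_nonneg (t : ℝ) : 0 ≤ rampDeriv t :=
  (rampDeriv_eq_zero (min_le_right t 1)).symm.le.trans (monotone_rampDeriv (min_le_left t 1))

lemma monotone_ramp : Monotone ramp :=
  monotone_of_deriv_nonneg (fun t => (hasDerivAt_ramp t).differentiableAt) fun t => by
    rw [(hasDerivAt_ramp t).deriv]; exact rampDeriv_nonneg t

lemma rampDeriv_le (t : ℝ) : rampDeriv t ≤ 3 := by
  have h0 : rampDeriv 0 = 0 := rampDeriv_eq_zero zero_le_one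
  have h3 : ∀ t, 0 ≤ t → rampDeriv t ≤ t := fun t ht => by
    have : rampDeriv t ≤ ∫ _ in (0 : ℝ)..t, (1 : ℝ) :=
      intervalIntegral.integral_mono_on ht (continuous_cut_sub.intervalIntegrable _ _)
        (continuous_const.intervalIntegrable _ _) fun u _ => cut.le_one
    simpa using this
  rcases le_total t 3 with ht | ht
  · exact (monotone_rampDeriv ht).trans (h3 3 (by norm_num))
  · have : rampDeriv t - rampDeriv 3 = 0 := by
      rw [rampDeriv, rampDeriv, intervalIntegral.integral_interval_sub_left
        (continuous_cut_sub.intervalIntegrable _ _) (continuous_cut_sub.intervalIntegrable _ _),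
        intervalIntegral.integral_congr (g := fun _ => (0 : ℝ)) fun u hu => ?_]
      · simp
      · rw [uIcc_of_le ht] at hu
        exact cut_eq_zero (by rw [abs_of_nonneg (by linarith [hu.1])]; linarith [hu.1])
    linarith [h3 3 (by norm_num)]

lemma one_le_rampDeriv {t : ℝ} (ht : 5 / 2 ≤ t) : 1 ≤ rampDeriv t := by
  have h : rampDeriv (5 / 2) - rampDeriv (3 / 2) = 1 := by
    rw [rampDeriv, rampDeriv, intervalIntegral.integral_interval_sub_left
      (continuous_cut_sub.intervalIntegrable _ _) (continuous_cut_sub.intervalIntegrable _ _),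
      intervalIntegral.integral_congr (g := fun _ => (1 : ℝ)) fun u hu => ?_]
    · norm_num
    · rw [uIcc_of_le (by norm_num)] at hu
      exact cut_eq_one (abs_le.2 ⟨by linarith [hu.1], by linarith [hu.2]⟩)
  linarith [monotone_rampDeriv ht, rampDeriv_nonneg (3 / 2)]

lemma ramp_eq_zero {t : ℝ} (ht : t ≤ 1) : ramp t = 0 := by
  rw [ramp, intervalIntegral.integral_congr (g := fun _ => (0 : ℝ)) fun u hu => ?_]
  · simp
  · exact rampDeriv_eq_zero (hu.2.trans (max_le zero_le_one ht))

lemma ramp_nonneg (t : ℝ) : 0 ≤ ramp t :=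
  (ramp_eq_zero (min_le_right t 1)).symm.le.trans (monotone_ramp (min_le_left t 1))

lemma sub_three_le_ramp (t : ℝ) : t - 3 ≤ ramp t := by
  rcases le_total t (5 / 2) with ht | ht
  · linarith [ramp_nonneg t]
  · have hm : MonotoneOn (fun t => ramp t - t) (Ici (5 / 2)) := by
      refine monotoneOn_of_deriv_nonneg (convex_Ici _)
        (contDiff_ramp.continuous.sub continuous_id).continuousOn
        (fun t _ => ((hasDerivAt_ramp t).sub
          (hasDerivAt_id t)).differentiableAt.differentiableWithinAt) fun t ht => ?_
      have : deriv (fun t => ramp t - t) t = rampDeriv t - 1 :=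
        ((hasDerivAt_ramp t).sub (hasDerivAt_id t)).deriv
      rw [this]
      linarith [one_le_rampDeriv (interior_subset ht : t ∈ Ici (5 / 2 : ℝ))]
    have := hm (mem_Ici.2 le_rfl) (mem_Ici.2 ht) ht
    simp only at this
    linarith [ramp_nonneg (5 / 2)]

/-! ### Convexity and smoothness from second derivatives along lines -/

section

variable {E : Type*} [NormedAddCommGroup E] [InnerProductSpace ℝ E] {F : E → ℝ}

lemma differentiable_fderiv_of_contDiff_two (hF : ContDiff ℝ 2 F) :
    Differentiable ℝ (fderiv ℝ F) :=
  (hF.fderiv_right (m := 1) (by norm_num)).differentiable one_ne_zero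

lemma hasDerivAt_comp_line (hF : ContDiff ℝ 2 F) (z v : E) (t : ℝ) :
    HasDerivAt (fun t : ℝ => F (z + t • v)) (fderiv ℝ F (z + t • v) v) t := by
  have hl : HasDerivAt (fun t : ℝ => z + t • v) v t := by
    simpa using ((hasDerivAt_id t).smul_const v).const_add z
  exact ((hF.differentiable two_ne_zero _).hasFDerivAt).comp_hasDerivAt t hl

lemma hasDerivAt_fderiv_comp_line (hF : ContDiff ℝ 2 F) (z v : E) (t : ℝ) :
    HasDerivAt (fun t : ℝ => fderiv ℝ F (z + t • v) v)
      (fderiv ℝ (fderiv ℝ F) (z + t • v) v v) t := by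
  have hl : HasDerivAt (fun t : ℝ => z + t • v) v t := by
    simpa using ((hasDerivAt_id t).smul_const v).const_add z
  have := ((differentiable_fderiv_of_contDiff_two hF _).hasFDerivAt).comp_hasDerivAt t hl
  exact this.clm_apply (hasDerivAt_const t v) |>.congr_deriv (by simp)

/-- This reduces the diagonal of the Hessian to one-variable calculus along lines. The diagonal
suffices for convexity and, by polarization, for smoothness. -/
lemma fderiv_fderiv_apply_eq (hF : ContDiff ℝ 2 F) {z v : E} {φ : ℝ → ℝ} {c : ℝ}
    (h1 : ∀ᶠ t in nhds (0 : ℝ), HasDerivAt (fun t : ℝ => F (z + t • v)) (φ t) t)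
    (h2 : HasDerivAt φ c 0) : fderiv ℝ (fderiv ℝ F) z v v = c := by
  have e : φ =ᶠ[nhds 0] fun t : ℝ => fderiv ℝ F (z + t • v) v := by
    filter_upwards [h1] with t ht
    exact ht.unique (hasDerivAt_comp_line hF z v t)
  have h := hasDerivAt_fderiv_comp_line hF z v 0
  rw [zero_smul, add_zero] at h
  exact (h.congr_of_eventuallyEq e).unique h2

lemma convexOn_of_fderiv_fderiv_nonneg (hF : ContDiff ℝ 2 F)
    (h : ∀ z v, 0 ≤ fderiv ℝ (fderiv ℝ F) z v v) : ConvexOn ℝ univ F := by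
  refine ⟨convex_univ, fun x _ y _ a b ha hb hab => ?_⟩
  have hc : ConvexOn ℝ univ fun t : ℝ => F (x + t • (y - x)) :=
    convexOn_of_hasDerivWithinAt2_nonneg convex_univ
      (fun t _ => (hasDerivAt_comp_line hF x (y - x) t).continuousAt.continuousWithinAt)
      (fun t _ => (hasDerivAt_comp_line hF x (y - x) t).hasDerivWithinAt)
      (fun t _ => (hasDerivAt_fderiv_comp_line hF x (y - x) t).hasDerivWithinAt)
      (fun t _ => h _ _)
  have := hc.2 (mem_univ 0) (mem_univ 1) ha hb hab
  simp only [smul_eq_mul, mul_zero, mul_one, zero_add, zero_smul, add_zero, one_smul,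
    add_sub_cancel] at this
  refine le_trans (le_of_eq ?_) this
  congr 1
  rw [show a = 1 - b by linarith, sub_smul, one_smul, smul_sub]
  abel

lemma norm_fderiv_sub_le (hF : ContDiff ℝ 2 F) {K : ℝ} (hK : 0 ≤ K)
    (h : ∀ z v, 0 ≤ fderiv ℝ (fderiv ℝ F) z v v)
    (h' : ∀ z v, fderiv ℝ (fderiv ℝ F) z v v ≤ K * ‖v‖ ^ 2) (x y : E) :
    ‖fderiv ℝ F x - fderiv ℝ F y‖ ≤ K * ‖x - y‖ := by
  have hbil : ∀ z u v, |fderiv ℝ (fderiv ℝ F) z u v| ≤ K * ‖u‖ * ‖v‖ := by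
    intro z u v
    set B := fderiv ℝ (fderiv ℝ F) z with hB
    have hsymm : ∀ u v, B u v = B v u := fun u v =>
      second_derivative_symmetric (fun y => (hF.differentiable two_ne_zero y).hasFDerivAt)
        ((differentiable_fderiv_of_contDiff_two hF z).hasFDerivAt) u v
    rcases (mul_nonneg (norm_nonneg u) (norm_nonneg v)).eq_or_lt' with h0 | h0
    · rcases mul_eq_zero.1 h0 with hu | hv
      · simp [norm_eq_zero.1 hu]
      · simp [norm_eq_zero.1 hv]
    -- Rescaling to equal norms makes polarization sharp: `4 B(p, q) = B(p + q, p + q) - B(p - q, p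
    -- - q)`, where both terms lie between `0` and `4K(‖u‖‖v‖)²`.
    set p := ‖v‖ • u
    set q := ‖u‖ • v
    have hn : ‖p‖ = ‖u‖ * ‖v‖ ∧ ‖q‖ = ‖u‖ * ‖v‖ := by
      constructor <;> simp [p, q, norm_smul, mul_comm]
    have hpq : B p q = ‖u‖ * ‖v‖ * B u v := by
      simp only [p, q, map_smul, smul_apply, smul_eq_mul]; ring
    have hplus : B (p + q) (p + q) = B p p + 2 * B p q + B q q := by
      simp only [map_add, add_apply, hsymm q p]; ring
    have hminus : B (p - q) (p - q) = B p p - 2 * B p q + B q q := by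
      simp only [map_sub, sub_apply, hsymm q p]; ring
    have n1 : ‖p + q‖ ≤ 2 * (‖u‖ * ‖v‖) := by
      refine (norm_add_le _ _).trans ?_; rw [hn.1, hn.2]; linarith
    have n2 : ‖p - q‖ ≤ 2 * (‖u‖ * ‖v‖) := by
      refine (norm_sub_le _ _).trans ?_; rw [hn.1, hn.2]; linarith
    have s1 := pow_le_pow_left₀ (norm_nonneg _) n1 2
    have s2 := pow_le_pow_left₀ (norm_nonneg _) n2 2
    have u1 := (h' z (p + q)).trans (mul_le_mul_of_nonneg_left s1 hK)
    have u2 := (h' z (p - q)).trans (mul_le_mul_of_nonneg_left s2 hK)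
    have l1 := h z (p + q)
    have l2 := h z (p - q)
    rw [← hB] at u1 u2 l1 l2
    have key : |B p q| ≤ K * (‖u‖ * ‖v‖) ^ 2 := abs_le.2 ⟨by nlinarith, by nlinarith⟩
    rw [hpq, abs_mul, abs_of_pos h0] at key
    refine le_of_mul_le_mul_left (key.trans (le_of_eq ?_)) h0
    ring
  refine Convex.norm_image_sub_le_of_norm_fderiv_le (s := univ)
    (fun z _ => differentiable_fderiv_of_contDiff_two hF z) (fun z _ => ?_) convex_univ
    (mem_univ _) (mem_univ _)
  exact ContinuousLinearMap.opNorm_le_bound _ hK fun u =>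
    ContinuousLinearMap.opNorm_le_bound _ (mul_nonneg hK (norm_nonneg _)) fun v => hbil z u v

end

/-- Adding a convex function with bounded second derivatives to the Gaussian potential. -/
lemma isPotential_half_sq_add {F : Plane → ℝ} (hF : ContDiff ℝ 2 F) {K κ : ℝ} (hK : 0 ≤ K)
    (h : ∀ z v, 0 ≤ fderiv ℝ (fderiv ℝ F) z v v)
    (h' : ∀ z v, fderiv ℝ (fderiv ℝ F) z v v ≤ K * ‖v‖ ^ 2) (hκ : K + 1 ≤ κ)
    (hF0 : ∀ z, F 0 ≤ F z) : IsPotential κ fun z => 1 / 2 * ‖z‖ ^ 2 + F z where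
  contDiff := (contDiff_const.mul (contDiff_norm_sq ℝ)).add hF
  strongConvex := by
    rw [strongConvexOn_iff_convex]
    simpa using convexOn_of_fderiv_fderiv_nonneg hF h
  smooth x y := by
    have hg : ∀ z, HasGradientAt (fun z : Plane => 1 / 2 * ‖z‖ ^ 2 + F z)
        (z + gradient F z) z := fun z => by
      have h2 := (hF.differentiable two_ne_zero z).hasGradientAt.hasFDerivAt
      have h1 := ((hasStrictFDerivAt_norm_sq z).hasFDerivAt).const_mul (1 / 2)
      rw [hasGradientAt_iff_hasFDerivAt]
      refine (h1.add h2).congr_fderiv ?_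
      ext v
      simp
    rw [(hg x).gradient, (hg y).gradient]
    have hdual : ‖gradient F x - gradient F y‖ = ‖fderiv ℝ F x - fderiv ℝ F y‖ := by
      rw [gradient, gradient, ← map_sub, LinearIsometryEquiv.norm_map]
    calc ‖x + gradient F x - (y + gradient F y)‖
        = ‖(x - y) + (gradient F x - gradient F y)‖ := by congr 1; abel
      _ ≤ ‖x - y‖ + K * ‖x - y‖ := by
        refine (norm_add_le _ _).trans (add_le_add le_rfl ?_)
        rw [hdual]; exact norm_fderiv_sub_le hF hK h h' x y
      _ ≤ κ * ‖x - y‖ := by nlinarith [norm_nonneg (x - y)]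
  isMin x := by
    have := hF0 x
    simp only [norm_zero]
    nlinarith [sq_nonneg ‖x‖]

/-! ### The perspective of a profile -/

/-- The positively homogeneous function on the plane whose restriction to the line `{(1, s)}`
is `f`. -/
def perspective (f : ℝ → ℝ) (z : Plane) : ℝ :=
  if 0 < z 0 then z 0 * f (z 1 / z 0) else ‖z‖ - z 0

/-- The potential attached to a profile. -/
def potential (A : ℝ) (f : ℝ → ℝ) (z : Plane) : ℝ := 1 / 2 * ‖z‖ ^ 2 + ramp (A * perspective f z)

lemma norm_sq_plane (z : Plane) : ‖z‖ ^ 2 = z 0 ^ 2 + z 1 ^ 2 := by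
  rw [EuclideanSpace.norm_sq_eq, Fin.sum_univ_two]
  simp

lemma abs_apply_le_norm (z : Plane) (i : Fin 2) : |z i| ≤ ‖z‖ := PiLp.norm_apply_le z i

lemma continuous_coord (i : Fin 2) : Continuous fun z : Plane => z i := by fun_prop

lemma norm_eq_mul_hyp {z : Plane} (hz : 0 < z 0) : ‖z‖ = z 0 * hyp (z 1 / z 0) := by
  have h : ‖z‖ ^ 2 = (z 0 * hyp (z 1 / z 0)) ^ 2 := by
    rw [norm_sq_plane, mul_pow, hyp_sq]; field_simp
  exact (pow_left_inj₀ (norm_nonneg _) (mul_nonneg hz.le (hyp_pos _).le) two_ne_zero).1 h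

lemma norm_le_two_mul {z : Plane} (hz : 0 < z 0) (hz1 : |z 1| ≤ z 0) : ‖z‖ ≤ 2 * z 0 := by
  refine abs_le_of_sq_le_sq' ?_ (by linarith) |>.2
  rw [norm_sq_plane]
  nlinarith [sq_le_sq' (abs_le.1 hz1).1 (abs_le.1 hz1).2]

lemma lt_abs_of_nonpos {z : Plane} (hz : z ≠ 0) (h : z 0 ≤ 0) : z 0 < |z 1| := by
  rcases h.lt_or_eq with h | h
  · exact h.trans_le (abs_nonneg _)
  · rw [h, abs_pos]
    intro h1
    refine hz ?_
    ext i
    fin_cases i <;> simp [h, h1]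

namespace IsProfile

variable {f : ℝ → ℝ} {θ : ℝ} (hf : IsProfile f θ)
include hf

lemma perspective_eq {z : Plane} (h : z 0 ≤ |z 1|) : perspective f z = ‖z‖ - z 0 := by
  rw [perspective]
  split_ifs with h0
  · rw [hf.eq_hyp, mul_sub, ← norm_eq_mul_hyp h0, mul_one]
    rwa [abs_div, abs_of_pos h0, one_le_div h0]
  · rfl

lemma eventually_perspective_eq {z : Plane} (h : z 0 < |z 1|) :
    ∀ᶠ w in nhds z, perspective f w = ‖w‖ - w 0 := by
  have h1 : ∀ᶠ w : Plane in nhds z, w 0 < |w 1| :=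
    (continuous_coord 0).continuousAt.eventually_lt (continuous_coord 1).abs.continuousAt h
  filter_upwards [h1] with w hw using hf.perspective_eq hw.le

omit hf in
lemma eventually_perspective_eq_mul {z : Plane} (h : 0 < z 0) :
    ∀ᶠ w in nhds z, perspective f w = w 0 * f (w 1 / w 0) := by
  have h1 : ∀ᶠ w : Plane in nhds z, 0 < w 0 :=
    (continuous_coord 0).continuousAt.eventually (lt_mem_nhds h)
  filter_upwards [h1] with w hw using if_pos hw

/-- Two formulas cover the punctured plane: the quotient formula where `z 0 > 0`, and `‖z‖ - z 0`
where `z 0 < |z 1|`. They agree on the overlap because the profile is the hyperbola off `[-1, 1]`.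
-/
lemma contDiffAt_perspective {z : Plane} (hz : z ≠ 0) : ContDiffAt ℝ 2 (perspective f) z := by
  have hc : ∀ i : Fin 2, ContDiff ℝ 2 fun z : Plane => z i := fun i => by fun_prop
  rcases lt_or_ge 0 (z 0) with h | h
  · refine ContDiffAt.congr_of_eventuallyEq ?_ (eventually_perspective_eq_mul h)
    exact (hc 0).contDiffAt.mul
      (hf.contDiff.contDiffAt.comp z ((hc 1).contDiffAt.div (hc 0).contDiffAt h.ne'))
  · refine ContDiffAt.congr_of_eventuallyEq ?_
      (hf.eventually_perspective_eq (lt_abs_of_nonpos hz h))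
    exact (contDiffAt_norm ℝ hz).sub (hc 0).contDiffAt

lemma abs_slope_sub_le {z : Plane} (h0 : 0 < z 0) (h1 : |z 1| ≤ z 0) : |z 1 / z 0 - θ| ≤ 2 := by
  have h : |z 1 / z 0| ≤ 1 := by rwa [abs_div, abs_of_pos h0, div_le_one h0]
  have := abs_sub (z 1 / z 0) θ
  linarith [hf.abs_le_one]

lemma perspective_le (z : Plane) : perspective f z ≤ 10 * ‖z‖ := by
  by_cases h : 0 < z 0 ∧ |z 1| ≤ z 0
  · rw [perspective, if_pos h.1]
    have h2 := abs_le.1 (hf.abs_slope_sub_le h.1 h.2)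
    have h3 : (z 1 / z 0 - θ) ^ 2 ≤ 4 := by nlinarith
    have h4 := (le_abs_self _).trans (hf.abs_apply_le (z 1 / z 0))
    have h5 := (le_abs_self _).trans (abs_apply_le_norm z 0)
    nlinarith [h.1]
  · have h1 : z 0 ≤ |z 1| := by
      rw [not_and, not_le] at h
      rcases lt_or_ge 0 (z 0) with h' | h'
      · exact (h h').le
      · exact h'.trans (abs_nonneg _)
    rw [hf.perspective_eq h1]
    have := neg_abs_le (z 0)
    linarith [abs_apply_le_norm z 0, norm_nonneg z]

/-- Homogeneous form of the quadratic growth of the profile, and the source of concentration.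
Outside the sector `|z 1| ≤ z 0` it holds because `‖z‖ - z 0` is at least `‖z‖ / 4` while the left
side is at most `2‖z‖²`. -/
lemma le_perspective (z : Plane) : (z 1 - θ * z 0) ^ 2 ≤ 10 * ‖z‖ * perspective f z := by
  by_cases h : 0 < z 0 ∧ |z 1| ≤ z 0
  · rw [perspective, if_pos h.1]
    have hs : |z 1 / z 0| ≤ 1 := by rw [abs_div, abs_of_pos h.1, div_le_one h.1]; exact h.2
    have h2 := hf.le_apply hs
    have h5 := (le_abs_self _).trans (abs_apply_le_norm z 0)
    have h6 : (z 1 - θ * z 0) ^ 2 = z 0 ^ 2 * (z 1 / z 0 - θ) ^ 2 := by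
      rw [← mul_pow]; congr 1; field_simp [h.1.ne']
    have h7 : 0 ≤ f (z 1 / z 0) := le_trans (by positivity) h2
    calc (z 1 - θ * z 0) ^ 2 ≤ 10 * z 0 * (z 0 * f (z 1 / z 0)) := by
          rw [h6]; nlinarith [mul_le_mul_of_nonneg_left h2 (sq_nonneg (z 0))]
      _ ≤ 10 * ‖z‖ * (z 0 * f (z 1 / z 0)) := by
          have := mul_nonneg h.1.le h7
          gcongr
  · have h1 : z 0 ≤ |z 1| := by
      rw [not_and, not_le] at h
      rcases lt_or_ge 0 (z 0) with h' | h'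
      · exact (h h').le
      · exact h'.trans (abs_nonneg _)
    rw [hf.perspective_eq h1]
    have hn := norm_sq_plane z
    have hN := norm_nonneg z
    have ha := abs_le.1 (abs_apply_le_norm z 0)
    have hθ := abs_le.1 hf.abs_le_one
    have hup : (z 1 - θ * z 0) ^ 2 ≤ 2 * ‖z‖ ^ 2 := by
      nlinarith [sq_nonneg (z 0 + θ * z 1), sq_nonneg (z 0), sq_nonneg (z 1),
        mul_nonneg (sub_nonneg.2 hθ.2) (neg_le_iff_add_nonneg'.1 hθ.1)]
    have hx : z 0 ≤ 3 / 4 * ‖z‖ := by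
      rcases le_or_gt (z 0) 0 with h0 | h0
      · linarith
      · have : z 0 ^ 2 ≤ z 1 ^ 2 := by rw [← sq_abs (z 1)]; exact pow_le_pow_left₀ h0.le h1 2
        nlinarith
    nlinarith

lemma perspective_nonneg (z : Plane) : 0 ≤ perspective f z := by
  rcases (norm_nonneg z).eq_or_lt' with h | h
  · rw [norm_eq_zero.1 h]; simp [perspective]
  · have := (sq_nonneg _).trans (hf.le_perspective z)
    exact nonneg_of_mul_nonneg_right this (by positivity)

/-- First and second derivatives of the perspective along a line, with their bounds. -/
lemma exists_line_derivs {z : Plane} (hz : z ≠ 0) (v : Plane) :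
    ∃ (φ : ℝ → ℝ) (c : ℝ),
      (∀ᶠ t in nhds (0 : ℝ), HasDerivAt (fun t : ℝ => perspective f (z + t • v)) (φ t) t) ∧
      HasDerivAt φ c 0 ∧ |φ 0| ≤ 16 * ‖v‖ ∧ 0 ≤ c ∧ c * ‖z‖ ≤ 16 * ‖v‖ ^ 2 := by
  have hline : ∀ t : ℝ, HasDerivAt (fun t : ℝ => z + t • v) v t := fun t => by
    simpa using ((hasDerivAt_id t).smul_const v).const_add z
  have hcont : Continuous fun t : ℝ => z + t • v := by fun_prop
  have hz0 : z + (0 : ℝ) • v = z := by simp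
  have hco : ∀ (i : Fin 2) (t : ℝ), HasDerivAt (fun t : ℝ => (z + t • v) i) (v i) t := fun i t => by
    have : HasDerivAt (fun t : ℝ => z i + t * v i) (v i) t := by
      simpa using ((hasDerivAt_id t).mul_const (v i)).const_add (z i)
    simpa using this
  have hv0 := abs_apply_le_norm v 0
  have hv1 := abs_apply_le_norm v 1
  by_cases h : 0 < z 0 ∧ |z 1| ≤ z 0
  · obtain ⟨h0, h1⟩ := h
    set X : ℝ → ℝ := fun t => (z + t • v) 0 with hX
    set s : ℝ → ℝ := fun t => (z + t • v) 1 / (z + t • v) 0 with hs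
    have hX0 : X 0 = z 0 := by simp [hX]
    have hs0 : s 0 = z 1 / z 0 := by simp [hs]
    have hXpos : ∀ᶠ t in nhds (0 : ℝ), 0 < X t := by
      have hXc : Continuous X := (continuous_coord 0).comp hcont
      exact hXc.continuousAt.eventually (lt_mem_nhds (by rwa [hX0]))
    have hsd : ∀ t, 0 < X t → HasDerivAt s ((v 1 - s t * v 0) / X t) t := fun t ht => by
      refine ((hco 1 t).div (hco 0 t) ht.ne').congr_deriv ?_
      have : (z + t • v) 0 ≠ 0 := ht.ne'
      simp only [hs, hX]
      field_simp
    -- As `X s' = v 1 - s v 0`, the terms in `f'` cancel in the second derivative and only the one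
    -- in `f''` survives.
    refine ⟨fun t => v 0 * f (s t) + deriv f (s t) * (v 1 - s t * v 0),
      deriv (deriv f) (s 0) * (v 1 - s 0 * v 0) ^ 2 / X 0, ?_, ?_, ?_, ?_, ?_⟩
    · filter_upwards [hXpos, hXpos.eventually_nhds] with t ht ht'
      have e : (fun t : ℝ => perspective f (z + t • v)) =ᶠ[nhds t] fun t => X t * f (s t) := by
        filter_upwards [ht'] with u hu using if_pos hu
      refine HasDerivAt.congr_of_eventuallyEq ?_ e
      refine ((hco 0 t).mul ((hf.hasDerivAt (s t)).comp t (hsd t ht))).congr_deriv ?_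
      have : (z + t • v) 0 ≠ 0 := ht.ne'
      simp only [Function.comp_apply, hX]
      field_simp
    · have hd := hsd 0 (by rwa [hX0])
      have d1 := ((hf.hasDerivAt (s 0)).comp 0 hd).const_mul (v 0)
      have d2 := ((hf.hasDerivAt_deriv (s 0)).comp 0 hd).mul ((hd.mul_const (v 0)).const_sub (v 1))
      refine (d1.add d2).congr_deriv ?_
      simp only [Function.comp_apply]
      ring
    · have hs2 : |s 0 - θ| ≤ 2 := by rw [hs0]; exact hf.abs_slope_sub_le h0 h1
      have hs1 : |s 0| ≤ 1 := by rw [hs0, abs_div, abs_of_pos h0, div_le_one h0]; exact h1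
      have b1 : |f (s 0)| ≤ 8 := by
        have := hf.abs_apply_le (s 0)
        rw [← sq_abs] at this
        nlinarith [abs_nonneg (s 0 - θ)]
      have b2 : |deriv f (s 0)| ≤ 4 := (hf.abs_deriv_le _).trans (by linarith)
      have b3 : |v 1 - s 0 * v 0| ≤ 2 * ‖v‖ := by
        refine (abs_sub _ _).trans ?_
        rw [abs_mul]
        nlinarith [abs_nonneg (v 0)]
      refine (abs_add_le _ _).trans ?_
      rw [abs_mul, abs_mul]
      have c1 : |v 0| * |f (s 0)| ≤ ‖v‖ * 8 := by gcongr
      have c2 : |deriv f (s 0)| * |v 1 - s 0 * v 0| ≤ 4 * (2 * ‖v‖) := by gcongr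
      linarith
    · rw [hX0]
      exact div_nonneg (mul_nonneg (hf.deriv2_nonneg _) (sq_nonneg _)) h0.le
    · have hs1 : |s 0| ≤ 1 := by rw [hs0, abs_div, abs_of_pos h0, div_le_one h0]; exact h1
      have b3 : |v 1 - s 0 * v 0| ≤ 2 * ‖v‖ := by
        refine (abs_sub _ _).trans ?_
        rw [abs_mul]
        nlinarith [abs_nonneg (v 0)]
      have b4 : (v 1 - s 0 * v 0) ^ 2 ≤ 4 * ‖v‖ ^ 2 := by
        rw [← sq_abs]
        nlinarith [abs_nonneg (v 1 - s 0 * v 0)]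
      have b5 := norm_le_two_mul h0 h1
      rw [hX0, div_mul_eq_mul_div, div_le_iff₀ h0]
      have b6 : deriv (deriv f) (s 0) * (v 1 - s 0 * v 0) ^ 2 ≤ 2 * (4 * ‖v‖ ^ 2) :=
        mul_le_mul (hf.deriv2_le _) b4 (sq_nonneg _) zero_le_two
      calc _ ≤ 2 * (4 * ‖v‖ ^ 2) * (2 * z 0) :=
            mul_le_mul b6 b5 (norm_nonneg _) (by positivity)
        _ = _ := by ring
  · have h1 : z 0 < |z 1| := by
      rw [not_and, not_le] at h
      rcases lt_or_ge 0 (z 0) with h' | h'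
      · exact h h'
      · exact lt_abs_of_nonpos hz h'
    set N : ℝ → ℝ := fun t => ‖z + t • v‖ with hN
    set p : ℝ → ℝ := fun t => inner ℝ (z + t • v) v with hp
    have hN0 : N 0 = ‖z‖ := by simp [hN]
    have hNpos : ∀ᶠ t in nhds (0 : ℝ), 0 < N t := by
      have hNc : Continuous N := hcont.norm
      exact hNc.continuousAt.eventually (lt_mem_nhds (by rw [hN0]; exact norm_pos_iff.2 hz))
    have hNd : ∀ t, 0 < N t → HasDerivAt N (p t / N t) t := fun t ht => by
      have h2 := ((hline t).norm_sq).sqrt (pow_pos ht 2).ne'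
      have e : (fun t : ℝ => √(‖z + t • v‖ ^ 2)) = N :=
        funext fun t => Real.sqrt_sq (norm_nonneg _)
      rw [e] at h2
      refine h2.congr_deriv ?_
      rw [Real.sqrt_sq (norm_nonneg _), mul_div_mul_left _ _ two_ne_zero]
    have hpd : ∀ t, HasDerivAt p (‖v‖ ^ 2) t := fun t => by
      refine ((hline t).inner ℝ (hasDerivAt_const t v)).congr_deriv ?_
      simp
    have hzpos : 0 < ‖z‖ := norm_pos_iff.2 hz
    have hCS : p 0 ^ 2 ≤ ‖z‖ ^ 2 * ‖v‖ ^ 2 := by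
      have := abs_real_inner_le_norm z v
      rw [← mul_pow, ← sq_abs]
      simp only [hp, hz0]
      exact pow_le_pow_left₀ (abs_nonneg _) this 2
    -- The second derivative of the norm along a line, nonnegative by Cauchy–Schwarz; the coordinate
    -- `z 0` is affine and adds nothing.
    refine ⟨fun t => p t / N t - v 0, (‖v‖ ^ 2 * ‖z‖ ^ 2 - p 0 ^ 2) / ‖z‖ ^ 3, ?_, ?_, ?_, ?_, ?_⟩
    · have hev : ∀ᶠ t in nhds (0 : ℝ), (z + t • v) 0 < |(z + t • v) 1| :=
        ((continuous_coord 0).comp hcont).continuousAt.eventually_lt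
          ((continuous_coord 1).comp hcont).abs.continuousAt (by simpa using h1)
      filter_upwards [hNpos, hev.eventually_nhds] with t ht ht'
      have e : (fun t : ℝ => perspective f (z + t • v)) =ᶠ[nhds t]
          fun t => N t - (z + t • v) 0 := by
        filter_upwards [ht'] with u hu using hf.perspective_eq hu.le
      exact ((hNd t ht).sub (hco 0 t)).congr_of_eventuallyEq e
    · refine (((hpd 0).div (hNd 0 (by rwa [hN0])) (by rw [hN0]; exact hzpos.ne')).sub_const
        (v 0)).congr_deriv ?_
      rw [hN0]
      field_simp
    · have c1 : |p 0 / N 0| ≤ ‖v‖ := by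
        rw [hN0, abs_div, abs_of_pos hzpos, div_le_iff₀ hzpos, mul_comm]
        simpa [hp] using abs_real_inner_le_norm z v
      have := abs_sub (p 0 / N 0) (v 0)
      linarith [norm_nonneg v]
    · refine div_nonneg ?_ (by positivity)
      nlinarith
    · rw [div_mul_eq_mul_div, div_le_iff₀ (by positivity)]
      have : 0 ≤ p 0 ^ 2 * ‖z‖ := by positivity
      have : 0 ≤ ‖v‖ ^ 2 * ‖z‖ ^ 3 := by positivity
      nlinarith

lemma eventually_ramp_eq_zero {A : ℝ} {z : Plane} (hA : 0 < A) (hz : 10 * A * ‖z‖ < 1) :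
    ∀ᶠ w in nhds z, ramp (A * perspective f w) = 0 := by
  have hc : Continuous fun w : Plane => 10 * A * ‖w‖ := by fun_prop
  filter_upwards [hc.continuousAt.eventually (gt_mem_nhds hz)] with w hw
  refine ramp_eq_zero ?_
  nlinarith [mul_le_mul_of_nonneg_left (hf.perspective_le w) hA.le]

lemma contDiff_ramp_perspective {A : ℝ} (hA : 0 < A) :
    ContDiff ℝ 2 fun z => ramp (A * perspective f z) := by
  refine contDiff_iff_contDiffAt.2 fun z => ?_
  rcases eq_or_ne z 0 with rfl | hz
  · exact contDiffAt_const.congr_of_eventuallyEq (hf.eventually_ramp_eq_zero hA (by simp))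
  · exact contDiff_ramp.contDiffAt.comp z (contDiffAt_const.mul (hf.contDiffAt_perspective hz))

/-- The curvature of the perspective is of order `1 / ‖z‖`, but the ramp is nonzero only where `10 A
‖z‖ ≥ 1`. There the chain rule gives at most `256 A²` from the curvature of the ramp and `3 * 160
A²` from its slope. -/
lemma fderiv_fderiv_ramp_perspective {A : ℝ} (hA : 0 < A) (z v : Plane) :
    0 ≤ fderiv ℝ (fderiv ℝ fun z => ramp (A * perspective f z)) z v v ∧
      fderiv ℝ (fderiv ℝ fun z => ramp (A * perspective f z)) z v v ≤
        999 * A ^ 2 * ‖v‖ ^ 2 := by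
  by_cases hs : 10 * A * ‖z‖ < 1
  · have e : (fun z => ramp (A * perspective f z)) =ᶠ[nhds z] fun _ => 0 :=
      hf.eventually_ramp_eq_zero hA hs
    rw [e.fderiv.fderiv_eq]
    simp only [fderiv_fun_const, Pi.zero_apply, fderiv_zero, zero_apply, le_refl, true_and]
    positivity
  · push Not at hs
    have hz : z ≠ 0 := by rintro rfl; simp at hs; linarith
    have hzpos : 0 < ‖z‖ := norm_pos_iff.2 hz
    obtain ⟨φ, c, h1, h2, h3, h4, h5⟩ := hf.exists_line_derivs hz v
    have e1 : ∀ᶠ t in nhds (0 : ℝ), HasDerivAt (fun t : ℝ => ramp (A * perspective f (z + t • v)))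
        (rampDeriv (A * perspective f (z + t • v)) * (A * φ t)) t := by
      filter_upwards [h1] with t ht
      exact (hasDerivAt_ramp _).comp t (ht.const_mul A)
    have e2 := ((hasDerivAt_rampDeriv _).comp (0 : ℝ) (h1.self_of_nhds.const_mul A)).mul
      (h2.const_mul A)
    rw [fderiv_fderiv_apply_eq (hf.contDiff_ramp_perspective hA) e1 e2]
    simp only [Function.comp_apply, zero_smul, add_zero]
    set k := cut (A * perspective f z - 2)
    set r := rampDeriv (A * perspective f z)
    have k0 : 0 ≤ k := cut.nonneg
    have k1 : k ≤ 1 := cut.le_one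
    have r0 : 0 ≤ r := rampDeriv_nonneg _
    have r1 : r ≤ 3 := rampDeriv_le _
    have hφ : φ 0 ^ 2 ≤ (16 * ‖v‖) ^ 2 := by
      rw [← sq_abs]; exact pow_le_pow_left₀ (abs_nonneg _) h3 2
    have hc : c ≤ 160 * A * ‖v‖ ^ 2 := by
      have : c * 1 ≤ c * (10 * A * ‖z‖) := mul_le_mul_of_nonneg_left hs h4
      nlinarith
    constructor
    · have : 0 ≤ k * (A * φ 0) * (A * φ 0) := by
        rw [mul_assoc]; exact mul_nonneg k0 (mul_self_nonneg _)
      have : 0 ≤ r * (A * c) := mul_nonneg r0 (mul_nonneg hA.le h4)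
      linarith
    · have b1 : k * (A * φ 0) * (A * φ 0) ≤ 1 * (A ^ 2 * (16 * ‖v‖) ^ 2) := by
        rw [mul_assoc, show A * φ 0 * (A * φ 0) = A ^ 2 * φ 0 ^ 2 by ring]
        gcongr
      have b2 : r * (A * c) ≤ 3 * (A * (160 * A * ‖v‖ ^ 2)) := by gcongr
      nlinarith [mul_nonneg (sq_nonneg A) (sq_nonneg ‖v‖)]

lemma isPotential_potential {A κ : ℝ} (hA : 1 ≤ A) (hκ : 1000 * A ^ 2 ≤ κ) :
    IsPotential κ (potential A f) := by
  have hA0 : 0 < A := one_pos.trans_le hA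
  refine isPotential_half_sq_add (hf.contDiff_ramp_perspective hA0) (K := 999 * A ^ 2)
    (by positivity) (fun z v => (hf.fderiv_fderiv_ramp_perspective hA0 z v).1)
    (fun z v => (hf.fderiv_fderiv_ramp_perspective hA0 z v).2) (by nlinarith) fun z => ?_
  rw [(hf.eventually_ramp_eq_zero hA0 (by simp)).self_of_nhds]
  exact ramp_nonneg _

end IsProfile

/-! ### Oracle answers reveal few bits -/

/-- Close to `z`, the potential depends on the bits only up to the first bit that departs from
the path of the direction of `z`. -/
lemma potential_eq_of_bitPath_ne {η A δ : ℝ} (h0 : 0 < η) (h1 : η ≤ 1 / 4)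
    {f g : ℝ → ℝ} {θ θ' : ℝ} (p : List Bool) (x : Bool) (t t' : List Bool)
    (hf : IsProfile f θ) (hg : IsProfile g θ')
    (hft : f = profile η (p ++ x :: t)) (hgt : g = profile η (p ++ x :: t'))
    (hA : 0 < A) (hδ : 80 * A * δ ≤ (η / 2) ^ (p.length + 1 + t.length))
    {z w : Plane} (hw : ‖w - z‖ ≤ δ) (hx : x ≠ bitPath η (z 1 / z 0) p.length 0 1) :
    potential A f w = potential A g w := by
  rw [potential, potential]
  congr 1
  by_cases hs : 10 * A * ‖w‖ < 1
  · rw [(hf.eventually_ramp_eq_zero hA hs).self_of_nhds,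
      (hg.eventually_ramp_eq_zero hA hs).self_of_nhds]
  push Not at hs
  rcases le_or_gt (w 0) |w 1| with hc | hc
  · rw [hf.perspective_eq hc, hg.perspective_eq hc]
  have hw0 : 0 < w 0 := (abs_nonneg _).trans_lt hc
  have hnorm := norm_le_two_mul hw0 hc.le
  have hd0 : |w 0 - z 0| ≤ δ := (abs_apply_le_norm (w - z) 0).trans hw
  have hd1 : |w 1 - z 1| ≤ δ := (abs_apply_le_norm (w - z) 1).trans hw
  have hδ0 : 0 ≤ δ := (norm_nonneg _).trans hw
  have hpow : (η / 2) ^ (p.length + 1 + t.length) ≤ 1 :=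
    pow_le_one₀ (by positivity) (by linarith)
  -- Here `w 0 ≥ 1 / (20A)`, since `1 ≤ 10A‖w‖` and `‖w‖ ≤ 2 * w 0`, while `δ ≤ 1 / (80A)`. So the
  -- slopes of `w` and `z` differ by at most `2δ / z 0 ≤ 80Aδ`.
  have hz : 1 ≤ 40 * A * z 0 := by
    have : A * (w 0 - z 0) ≤ A * δ := mul_le_mul_of_nonneg_left (abs_le.1 hd0).2 hA.le
    nlinarith
  have hz0 : 0 < z 0 := by
    have : 0 < A * z 0 := by linarith
    exact (pos_iff_pos_of_mul_pos this).1 hA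
  have hslope : |w 1 / w 0 - z 1 / z 0| ≤ (η / 2) ^ (p.length + 1 + t.length) * 1 := by
    have e : w 1 / w 0 - z 1 / z 0 =
        (w 1 * (z 0 - w 0) + w 0 * (w 1 - z 1)) / (w 0 * z 0) := by
      field_simp; ring
    rw [e, mul_one, abs_div, abs_of_pos (mul_pos hw0 hz0), div_le_iff₀ (mul_pos hw0 hz0)]
    have b : |w 1 * (z 0 - w 0) + w 0 * (w 1 - z 1)| ≤ w 0 * δ + w 0 * δ := by
      refine (abs_add_le _ _).trans ?_
      rw [abs_mul, abs_mul, abs_of_pos hw0, abs_sub_comm (z 0)]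
      gcongr
    have b2 : 2 * δ ≤ (80 * A * δ) * z 0 := by nlinarith
    calc _ ≤ w 0 * (2 * δ) := by linarith
      _ ≤ w 0 * ((η / 2) ^ (p.length + 1 + t.length) * z 0) := by
        refine mul_le_mul_of_nonneg_left (b2.trans ?_) hw0.le
        exact mul_le_mul_of_nonneg_right hδ hz0.le
      _ = _ := by ring
  rw [perspective, perspective, if_pos hw0, if_pos hw0, hft, hgt, profile, profile,
    tilt_eq_of_bitPath_ne h0 h1 (z 1 / z 0) (w 1 / w 0) p x t t' 0 one_pos hslope hx]

lemma extendedOracle_congr {δ : ℝ} {V W : Plane → ℝ} {z : Plane}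
    (h : ∀ w, ‖w - z‖ ≤ δ → V w = W w) : extendedOracle δ V z = extendedOracle δ W z := by
  funext u
  exact h _ (by rw [add_sub_cancel_left]; exact mem_closedBall_zero_iff.1 u.2)

lemma firstOrderOracle_congr {δ : ℝ} (hδ : 0 < δ) {V W : Plane → ℝ} {z : Plane}
    (h : ∀ w, ‖w - z‖ ≤ δ → V w = W w) : firstOrderOracle V z = firstOrderOracle W z := by
  have e : V =ᶠ[nhds z] W := by
    filter_upwards [Metric.closedBall_mem_nhds z hδ] with w hw
    exact h w (by rwa [← dist_eq_norm])
  rw [firstOrderOracle, firstOrderOracle, e.eq_of_nhds, gradient, gradient, e.fderiv_eq]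

/-! ### Counting transcripts -/

/-- All lists of `n` bits. -/
def bitLists : ℕ → Finset (List Bool)
  | 0 => {[]}
  | n + 1 => (bitLists n).image (true :: ·) ∪ (bitLists n).image (false :: ·)

lemma length_of_mem_bitLists {n : ℕ} {t : List Bool} (ht : t ∈ bitLists n) : t.length = n := by
  induction n generalizing t with
  | zero => simpa [bitLists] using ht
  | succ n ih =>
    simp only [bitLists, Finset.mem_union, Finset.mem_image] at ht
    rcases ht with ⟨t, ht, rfl⟩ | ⟨t, ht, rfl⟩ <;> simp [ih ht]

lemma card_bitLists (n : ℕ) : (bitLists n).card = 2 ^ n := by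
  induction n with
  | zero => rfl
  | succ n ih =>
    rw [bitLists, Finset.card_union_of_disjoint, Finset.card_image_of_injective _
      (List.cons_injective), Finset.card_image_of_injective _ (List.cons_injective), ih, pow_succ]
    · ring
    · rw [Finset.disjoint_left]
      simp only [Finset.mem_image]
      rintro _ ⟨t, _, rfl⟩ ⟨t', _, h⟩
      simp at h

open scoped Classical in
/-- If each step from any state reveals the hidden list of `J` bits only up to its first
disagreement with some list, then few states are reached after `n` steps. -/
lemma card_image_iterate_le {σ : Type*} (step : List Bool → σ → σ) (J : ℕ)
    (hstep : ∀ H, ∃ c : ℕ → Bool, ∀ (p : List Bool) (x : Bool) (t t' : List Bool),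
      p.length + 1 + t.length = J → p.length + 1 + t'.length = J → x ≠ c p.length →
        step (p ++ x :: t) H = step (p ++ x :: t') H)
    (n m : ℕ) (p : List Bool) (hp : p.length + m = J) (H : σ) :
    (((bitLists m).image fun t => (step (p ++ t))^[n] H).card : ℝ) ≤ 2 ^ n * (3 / 2) ^ m := by
  induction n generalizing m p H with
  | zero =>
    have : (((bitLists m).image fun t => (step (p ++ t))^[0] H).card : ℝ) ≤ 1 := by
      norm_cast
      refine Finset.card_le_one.2 fun a ha b hb => ?_
      simp only [Finset.mem_image] at ha hb
      obtain ⟨_, _, rfl⟩ := ha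
      obtain ⟨_, _, rfl⟩ := hb
      rfl
    refine this.trans ?_
    rw [pow_zero, one_mul]
    exact one_le_pow₀ (by norm_num)
  | succ n ihn =>
    obtain ⟨c, hc⟩ := hstep H
    induction m generalizing p with
    | zero =>
      simp only [bitLists, Finset.image_singleton, Finset.card_singleton, Nat.cast_one, pow_zero,
        mul_one]
      exact one_le_pow₀ (by norm_num)
    | succ m ihm =>
      -- the half that follows `c` and the half that departs from it
      have hsame : ∀ x, (((bitLists m).image fun t => (step (p ++ x :: t))^[n + 1] H).card : ℝ) ≤
          2 ^ (n + 1) * (3 / 2) ^ m := fun x => by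
        -- The state is unchanged: the bit `x` just joins the known prefix, with all `n + 1` steps
        -- left.
        have := ihm (p ++ [x]) (by rw [List.length_append, List.length_singleton]; omega)
        simpa using this
      have hdiff : ∀ x, x ≠ c p.length →
          (((bitLists m).image fun t => (step (p ++ x :: t))^[n + 1] H).card : ℝ) ≤
            2 ^ n * (3 / 2) ^ m := fun x hx => by
        -- When `x` departs from `c`, the first step does not depend on the later bits, so one step
        -- is spent and a common state is reached; the tail of `true` is an arbitrary
        -- representative.
        have := ihn m (p ++ [x]) (by rw [List.length_append, List.length_singleton]; omega)
          (step (p ++ x :: List.replicate m true) H)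
        refine le_trans (le_of_eq ?_) this
        congr 2
        refine Finset.image_congr fun t ht => ?_
        rw [Function.iterate_succ_apply, hc p x t (List.replicate m true) _ _ hx]
        · simp
        · rw [length_of_mem_bitLists ht]; omega
        · rw [List.length_replicate]; omega
      have hunion : (((bitLists (m + 1)).image fun t => (step (p ++ t))^[n + 1] H).card : ℝ) ≤
          ((bitLists m).image fun t => (step (p ++ true :: t))^[n + 1] H).card +
          ((bitLists m).image fun t => (step (p ++ false :: t))^[n + 1] H).card := by
        rw [bitLists, Finset.image_union, Finset.image_image, Finset.image_image]
        exact_mod_cast Finset.card_union_le _ _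
      refine hunion.trans ?_
      -- The bound solves the recursion `N(n + 1, m + 1) ≤ N(n + 1, m) + N(n, m)` exactly.
      have hfin : (2 : ℝ) ^ (n + 1) * (3 / 2) ^ m + 2 ^ n * (3 / 2) ^ m =
          2 ^ (n + 1) * (3 / 2) ^ (m + 1) := by ring
      rw [← hfin]
      cases hcp : c p.length
      · have := hsame false
        have := hdiff true (by simp [hcp])
        linarith
      · have := hsame true
        have := hdiff false (by simp [hcp])
        linarith

namespace SamplingAlgorithm

variable {R : Type}

lemma transcript_eq_iterate (A : SamplingAlgorithm.{u} R) (respond : Plane → R) (ζ : A.Seed)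
    (n : ℕ) : A.transcript respond ζ n =
      (fun H => H ++ [(A.query ζ H, respond (A.query ζ H))])^[n] [] := by
  induction n with
  | zero => rfl
  | succ n ih => rw [Function.iterate_succ_apply', ← ih, transcript]

open scoped Classical in
/-- For each seed, few of the `2 ^ J` instances are identified by the output. -/
lemma card_filter_sample_mem_le (A : SamplingAlgorithm.{u} R) (respond : List Bool → Plane → R)
    (J : ℕ) (hres : ∀ z, ∃ c : ℕ → Bool, ∀ (p : List Bool) (x : Bool) (t t' : List Bool),
      p.length + 1 + t.length = J → p.length + 1 + t'.length = J → x ≠ c p.length →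
        respond (p ++ x :: t) z = respond (p ++ x :: t') z)
    (S : List Bool → Set Plane)
    (hS : ∀ b ∈ bitLists J, ∀ b' ∈ bitLists J, b ≠ b' → Disjoint (S b) (S b'))
    (n : ℕ) (ζ : A.Seed) :
    (((bitLists J).filter fun b => A.sample (respond b) n ζ ∈ S b).card : ℝ) ≤
      2 ^ n * (3 / 2) ^ J := by
  set step : List Bool → List (Plane × R) → List (Plane × R) := fun b H =>
    H ++ [(A.query ζ H, respond b (A.query ζ H))] with hstep
  have hcount := card_image_iterate_le step J (fun H => by
    obtain ⟨c, hc⟩ := hres (A.query ζ H)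
    exact ⟨c, fun p x t t' h h' hx => by simp only [hstep, hc p x t t' h h' hx]⟩)
    n J [] (by simp) []
  refine le_trans ?_ hcount
  norm_cast
  have htr : ∀ b, (step b)^[n] [] = A.transcript (respond b) ζ n := fun b =>
    (A.transcript_eq_iterate (respond b) ζ n).symm
  -- Equal transcripts give equal outputs, and one output cannot lie in two disjoint targets.
  refine Finset.card_le_card_of_injOn (fun b => (step b)^[n] []) (fun b hb => ?_) ?_
  · simp only [Finset.coe_filter, mem_ofPred_eq] at hb
    simpa using ⟨b, hb.1, rfl⟩
  · intro b hb b' hb' hbb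
    simp only [Finset.coe_filter, mem_ofPred_eq] at hb hb'
    simp only [htr] at hbb
    by_contra hne
    refine Set.disjoint_left.1 (hS b hb.1 b' hb'.1 hne) hb.2 ?_
    have := hb'.2
    rwa [sample, ← hbb] at this

open scoped Classical in
/-- If an algorithm hits each of a disjoint family of targets with probability at least `q`,
then it has asked many queries. -/
lemma mul_two_pow_le (A : SamplingAlgorithm.{u} R) (respond : List Bool → Plane → R)
    (J : ℕ) (hres : ∀ z, ∃ c : ℕ → Bool, ∀ (p : List Bool) (x : Bool) (t t' : List Bool),
      p.length + 1 + t.length = J → p.length + 1 + t'.length = J → x ≠ c p.length →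
        respond (p ++ x :: t) z = respond (p ++ x :: t') z)
    (S : List Bool → Set Plane) (hSm : ∀ b, MeasurableSet (S b))
    (hS : ∀ b ∈ bitLists J, ∀ b' ∈ bitLists J, b ≠ b' → Disjoint (S b) (S b'))
    (n : ℕ) (hm : ∀ b ∈ bitLists J, AEMeasurable (A.sample (respond b) n) A.law) {q : ℝ}
    (hq : ∀ b ∈ bitLists J, q ≤ (A.law.map (A.sample (respond b) n)).real (S b)) :
    q * 2 ^ J ≤ 2 ^ n * (3 / 2) ^ J := by
  have hnull : ∀ b ∈ bitLists J, NullMeasurableSet (A.sample (respond b) n ⁻¹' S b) A.law :=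
    fun b hb => (hm b hb).nullMeasurable (hSm b)
  have hint : ∀ b ∈ bitLists J,
      Integrable ((A.sample (respond b) n ⁻¹' S b).indicator fun _ => (1 : ℝ)) A.law :=
    fun b hb => (integrable_const 1).indicator₀ (hnull b hb)
  calc q * 2 ^ J = ∑ _b ∈ bitLists J, q := by
        rw [Finset.sum_const, card_bitLists, nsmul_eq_mul]; push_cast; ring
    _ ≤ ∑ b ∈ bitLists J, ∫ ζ, (A.sample (respond b) n ⁻¹' S b).indicator (fun _ => (1 : ℝ)) ζ
          ∂A.law := by
        refine Finset.sum_le_sum fun b hb => (hq b hb).trans (le_of_eq ?_)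
        rw [integral_indicator₀ (hnull b hb), setIntegral_const, smul_eq_mul, mul_one,
          measureReal_def, measureReal_def, Measure.map_apply_of_aemeasurable (hm b hb) (hSm b)]
    _ = ∫ ζ, ∑ b ∈ bitLists J, (A.sample (respond b) n ⁻¹' S b).indicator (fun _ => (1 : ℝ)) ζ
          ∂A.law := (integral_finsetSum _ hint).symm
    _ ≤ ∫ _, 2 ^ n * (3 / 2) ^ J ∂A.law := by
        refine integral_mono (integrable_finsetSum _ hint) (integrable_const _) fun ζ => ?_
        refine le_trans (le_of_eq ?_) (A.card_filter_sample_mem_le respond J hres S hS n ζ)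
        simp only [Set.indicator_apply, Set.mem_preimage]
        rw [Finset.sum_ite, Finset.sum_const_zero, add_zero, Finset.sum_const, nsmul_eq_mul,
          mul_one]
    _ = 2 ^ n * (3 / 2) ^ J := by simp

end SamplingAlgorithm

lemma sub_le_measureReal_of_tvDist_le {α : Type*} [MeasurableSpace α] {μ ν : Measure α}
    [IsProbabilityMeasure μ] [IsProbabilityMeasure ν] {ε : ℝ} (h : tvDist μ ν ≤ ε) {S : Set α}
    (hS : MeasurableSet S) : ν.real S - ε ≤ μ.real S := by
  -- Boundedness is needed because the real supremum of an unbounded family is `0` by convention.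
  have hb : BddAbove (range fun S : {S : Set α // MeasurableSet S} =>
      |μ.real S.1 - ν.real S.1|) := by
    refine ⟨1, ?_⟩
    rintro _ ⟨S, rfl⟩
    have h1 : μ.real S.1 ≤ 1 := measureReal_le_one
    have h2 : ν.real S.1 ≤ 1 := measureReal_le_one
    have h3 : 0 ≤ μ.real S.1 := measureReal_nonneg
    have h4 : 0 ≤ ν.real S.1 := measureReal_nonneg
    exact abs_le.2 ⟨by linarith, by linarith⟩
  have := (le_ciSup hb ⟨S, hS⟩).trans h
  have := (abs_le.1 this).1
  simp only at this
  linarith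

/-! ### Concentration around a direction -/

/-- The punctured double cone of aperture `w` around the line of slope `θ`. -/
def cone (θ w : ℝ) : Set Plane := {z | z ≠ 0 ∧ |z 1 - θ * z 0| ≤ w * ‖z‖}

lemma measurableSet_cone (θ w : ℝ) : MeasurableSet (cone θ w) := by
  have h : IsClosed {z : Plane | |z 1 - θ * z 0| ≤ w * ‖z‖} :=
    isClosed_le (by fun_prop) (by fun_prop)
  exact (measurableSet_singleton (0 : Plane)).compl.inter h.measurableSet

/-- As `|θ| ≤ 1`, the cone stays away from the vertical axis: `|z 0| ≥ 3/8 ‖z‖` on it. A common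
point would then give `6w * 3/8 ≤ 2w`. -/
lemma disjoint_cone {θ θ' w : ℝ} (hθ : |θ| ≤ 1) (hw0 : 0 < w) (hw : w ≤ 1 / 4) (h : 6 * w ≤ |θ - θ'|) :
    Disjoint (cone θ w) (cone θ' w) := by
  rw [Set.disjoint_left]
  rintro z ⟨hz, h1⟩ ⟨-, h2⟩
  have hpos : 0 < ‖z‖ := norm_pos_iff.2 hz
  have hd : |θ - θ'| * |z 0| ≤ 2 * w * ‖z‖ := by
    rw [← abs_mul, show (θ - θ') * z 0 = (z 1 - θ' * z 0) - (z 1 - θ * z 0) by ring]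
    have := abs_sub (z 1 - θ' * z 0) (z 1 - θ * z 0)
    linarith
  have hy : |z 1| ≤ |z 0| + w * ‖z‖ := by
    have := abs_add_le (z 1 - θ * z 0) (θ * z 0)
    rw [sub_add_cancel, abs_mul] at this
    nlinarith [abs_nonneg (z 0)]
  have hr : ‖z‖ ≤ |z 0| + |z 1| := by
    refine abs_le_of_sq_le_sq' ?_ (by positivity) |>.2
    rw [norm_sq_plane, ← sq_abs (z 0), ← sq_abs (z 1)]
    nlinarith [abs_nonneg (z 0), abs_nonneg (z 1)]
  have hx : 3 / 8 * ‖z‖ ≤ |z 0| := by nlinarith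
  have hle : 6 * w * (3 / 8 * ‖z‖) ≤ 2 * w * ‖z‖ :=
    (mul_le_mul h hx (by positivity) (abs_nonneg _)).trans hd
  nlinarith [mul_pos hw0 hpos]

lemma integrable_exp_neg_norm : Integrable fun z : Plane => Real.exp (-‖z‖) := by
  have h := (integrable_one_add_norm (E := Plane) (μ := volume) (r := 3)
    (by simp; norm_num)).const_mul (6 * Real.exp 1)
  refine h.mono' (by fun_prop) (Filter.Eventually.of_forall fun z => ?_)
  have hz : 0 ≤ 1 + ‖z‖ := by positivity
  have h3 : (1 + ‖z‖) ^ 3 / 6 ≤ Real.exp (1 + ‖z‖) := by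
    simpa [Nat.factorial] using Real.pow_div_factorial_le_exp _ hz 3
  rw [Real.norm_of_nonneg (Real.exp_pos _).le, Real.rpow_neg hz, Real.exp_neg,
    show (1 + ‖z‖) ^ (3 : ℝ) = (1 + ‖z‖) ^ 3 by norm_cast, ← div_eq_mul_inv,
    le_div_iff₀ (by positivity), inv_mul_le_iff₀ (Real.exp_pos _), mul_comm]
  rw [Real.exp_add] at h3
  linarith

lemma integral_exp_neg_mul_norm {a : ℝ} (ha : 0 < a) :
    ∫ z : Plane, Real.exp (-(a * ‖z‖)) = (a ^ 2)⁻¹ * ∫ z : Plane, Real.exp (-‖z‖) := by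
  have h := Measure.integral_comp_smul (volume : Measure Plane) (fun z => Real.exp (-‖z‖)) a
  simp only [norm_smul, Real.norm_of_nonneg ha.le, finrank_euclideanSpace, Fintype.card_fin,
    smul_eq_mul] at h
  rw [h, abs_of_pos (by positivity)]

lemma integrable_exp_neg_mul_norm {a : ℝ} (ha : 0 < a) :
    Integrable fun z : Plane => Real.exp (-(a * ‖z‖)) := by
  have h := integrable_exp_neg_norm.comp_smul ha.ne'
  simpa only [norm_smul, Real.norm_of_nonneg ha.le] using h

namespace IsProfile

variable {f : ℝ → ℝ} {θ : ℝ} (hf : IsProfile f θ)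
include hf

lemma continuous_potential {A : ℝ} (hA : 0 < A) : Continuous (potential A f) :=
  (by fun_prop : Continuous fun z : Plane => 1 / 2 * ‖z‖ ^ 2).add
    (hf.contDiff_ramp_perspective hA).continuous

lemma integrable_exp_neg_potential {A : ℝ} (hA : 0 < A) :
    Integrable fun z => Real.exp (-potential A f z) := by
  refine (integrable_exp_neg_norm.const_mul (Real.exp (1 / 2))).mono'
    (hf.continuous_potential hA).neg.rexp.aestronglyMeasurable
    (Filter.Eventually.of_forall fun z => ?_)
  rw [Real.norm_of_nonneg (Real.exp_pos _).le, ← Real.exp_add, Real.exp_le_exp, potential]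
  nlinarith [ramp_nonneg (A * perspective f z), sq_nonneg (‖z‖ - 1)]

/-- Off the cone around its direction, the potential grows fast. -/
lemma le_potential_of_notMem_cone {A w : ℝ} (hA : 0 < A) (hw : 0 ≤ w) {z : Plane}
    (hz : z ∉ cone θ w) : A * w ^ 2 / 10 * ‖z‖ - 3 ≤ potential A f z := by
  have hramp := sub_three_le_ramp (A * perspective f z)
  have hsq := sq_nonneg ‖z‖
  rw [potential]
  rcases eq_or_ne z 0 with rfl | h0
  · simp only [norm_zero]
    nlinarith [mul_nonneg hA.le (hf.perspective_nonneg (0 : Plane))]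
  have hpos : 0 < ‖z‖ := norm_pos_iff.2 h0
  have h1 : w * ‖z‖ < |z 1 - θ * z 0| := by
    by_contra h
    exact hz ⟨h0, not_lt.1 h⟩
  have h2 : (w * ‖z‖) ^ 2 ≤ 10 * ‖z‖ * perspective f z := by
    refine le_trans ?_ (hf.le_perspective z)
    rw [← sq_abs (z 1 - θ * z 0)]
    exact pow_le_pow_left₀ (by positivity) h1.le 2
  have h3 : w ^ 2 * ‖z‖ ≤ 10 * perspective f z := by
    refine le_of_mul_le_mul_right ?_ hpos
    linarith
  nlinarith

/-- On a small ball around a point of its direction, the potential is bounded and the ball lies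
in the cone. -/
lemma potential_le_of_mem_ball {A w : ℝ} (hA : 1 ≤ A) (hw : 0 ≤ w) (hAw : 1 ≤ A * w ^ 2)
    {z : Plane} (hz : z ∈ Metric.ball (!₂[1, θ] : Plane) (1 / (4 * √A))) :
    z ∈ cone θ w ∧ potential A f z ≤ 8 := by
  set a := 1 / (4 * √A) with ha
  have hsA : 1 ≤ √A := Real.one_le_sqrt.2 hA
  have hsA0 : 0 < √A := one_pos.trans_le hsA
  have ha4 : a ≤ 1 / 4 := by
    rw [ha]; exact one_div_le_one_div_of_le (by norm_num) (by linarith)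
  have ha0 : 0 < a := by positivity
  have hAa : A * a ^ 2 = 1 / 16 := by
    rw [ha, div_pow, mul_pow, Real.sq_sqrt (by linarith)]; field_simp; norm_num
  rw [Metric.mem_ball, dist_eq_norm] at hz
  have d0 : |z 0 - 1| ≤ a := by
    simpa using (abs_apply_le_norm (z - !₂[1, θ]) 0).trans hz.le
  have d1 : |z 1 - θ| ≤ a := by
    simpa using (abs_apply_le_norm (z - !₂[1, θ]) 1).trans hz.le
  have hθ := hf.abs_le_one
  have hx := abs_le.1 d0
  have hx0 : 3 / 4 ≤ z 0 := by linarith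
  have hz0 : 0 < z 0 := by linarith
  have hdev : |z 1 - θ * z 0| ≤ 2 * a := by
    rw [show z 1 - θ * z 0 = (z 1 - θ) - θ * (z 0 - 1) by ring]
    refine (abs_sub _ _).trans ?_
    rw [abs_mul]
    nlinarith [abs_nonneg (z 0 - 1)]
  have hnx : z 0 ≤ ‖z‖ := (le_abs_self _).trans (abs_apply_le_norm z 0)
  have hne : z ≠ 0 := by rintro rfl; simp at hz0
  refine ⟨⟨hne, hdev.trans ?_⟩, ?_⟩
  · have haw : 4 * a ≤ w := by
      refine abs_le_of_sq_le_sq' ?_ hw |>.2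
      have : A * (4 * a) ^ 2 ≤ A * w ^ 2 := by nlinarith
      exact le_of_mul_le_mul_left this (by linarith)
    nlinarith
  · have hp : A * perspective f z ≤ 1 := by
      rw [perspective, if_pos hz0]
      have h1 := (le_abs_self _).trans (hf.abs_apply_le (z 1 / z 0))
      have h2 : z 0 * (z 0 * f (z 1 / z 0)) ≤ 2 * (z 1 - θ * z 0) ^ 2 := by
        have e : (z 1 - θ * z 0) ^ 2 = z 0 ^ 2 * (z 1 / z 0 - θ) ^ 2 := by
          rw [← mul_pow]; congr 1; field_simp
        rw [e]
        nlinarith [mul_le_mul_of_nonneg_left h1 (sq_nonneg (z 0))]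
      have h3 : (z 1 - θ * z 0) ^ 2 ≤ 4 * a ^ 2 := by
        rw [← sq_abs]
        nlinarith [abs_nonneg (z 1 - θ * z 0)]
      have h4 : z 0 * (A * (z 0 * f (z 1 / z 0))) ≤ 1 / 2 := by nlinarith
      by_contra hcon
      push Not at hcon
      nlinarith
    rw [potential, ramp_eq_zero hp, add_zero, norm_sq_plane]
    have hy := abs_le.1 d1
    have hθ' := abs_le.1 hθ
    nlinarith

end IsProfile

/-- The Gibbs measure of the potential gives most of its mass to the cone around its
direction. -/
lemma exists_half_le_gibbs_cone :
    ∃ R : ℝ, 1 ≤ R ∧ ∀ (f : ℝ → ℝ) (θ w A : ℝ), IsProfile f θ → 0 < w → w ≤ 1 →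
      R ≤ A * w ^ 4 → 1 / 2 ≤ (gibbs (potential A f)).real (cone θ w) := by
  set E := ∫ z : Plane, Real.exp (-‖z‖) with hE
  set v := (volume : Measure Plane).real (Metric.ball 0 1) with hv
  have hv0 : 0 < v := ENNReal.toReal_pos (Metric.measure_ball_pos _ _ one_pos).ne'
    measure_ball_lt_top.ne
  -- The mass outside is at most `e³ (10 / (A w²))² E`, the mass inside at least `e⁻⁸ v / (16A)`.
  -- The former is the smaller as soon as `A w⁴ ≥ 1600 e¹¹ E / v`.
  refine ⟨max 1 (1600 * Real.exp 11 * E / v), le_max_left _ _, ?_⟩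
  intro f θ w A hf hw hw1 hR
  have hR1 : 1 ≤ A * w ^ 4 := (le_max_left _ _).trans hR
  have hR2 : 1600 * Real.exp 11 * E / v ≤ A * w ^ 4 := (le_max_right _ _).trans hR
  have hA0 : 0 < A := by
    by_contra h
    push Not at h
    nlinarith [pow_pos hw 4]
  have hw4 : w ^ 4 ≤ w ^ 2 := pow_le_pow_of_le_one hw.le hw1 (by norm_num)
  have hw2 : w ^ 2 ≤ 1 := pow_le_one₀ hw.le hw1
  have hAw : 1 ≤ A * w ^ 2 := hR1.trans (mul_le_mul_of_nonneg_left hw4 hA0.le)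
  have hA : 1 ≤ A := by nlinarith
  set g : Plane → ℝ := fun z => Real.exp (-potential A f z) with hg
  have hgi : Integrable g := hf.integrable_exp_neg_potential hA0
  have hg0 : ∀ z, 0 ≤ g z := fun z => (Real.exp_pos _).le
  have hSm := measurableSet_cone θ w
  -- the mass inside the cone
  set a := 1 / (4 * √A) with ha
  have ha0 : 0 ≤ a := by positivity
  have hvol : (volume : Measure Plane).real (Metric.ball (!₂[1, θ] : Plane) a) = v / (16 * A) := by
    rw [measureReal_def, Measure.addHaar_ball _ _ ha0, ENNReal.toReal_mul,
      ENNReal.toReal_ofReal (by positivity), finrank_euclideanSpace, Fintype.card_fin, ha, div_pow,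
      mul_pow, Real.sq_sqrt hA0.le, hv, measureReal_def]
    ring
  have hin : Real.exp (-8) * (v / (16 * A)) ≤ ∫ z in cone θ w, g z := by
    calc Real.exp (-8) * (v / (16 * A))
        = ∫ _ in Metric.ball (!₂[1, θ] : Plane) a, Real.exp (-8) := by
          rw [setIntegral_const, hvol, smul_eq_mul, mul_comm]
      _ ≤ ∫ z in Metric.ball (!₂[1, θ] : Plane) a, g z := by
          refine setIntegral_mono_on (integrableOn_const measure_ball_lt_top.ne) hgi.integrableOn
            measurableSet_ball fun z hz => ?_
          exact Real.exp_le_exp.2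
            (neg_le_neg (hf.potential_le_of_mem_ball hA hw.le hAw hz).2)
      _ ≤ ∫ z in cone θ w, g z :=
          setIntegral_mono_set hgi.integrableOn (Filter.Eventually.of_forall hg0)
            (Filter.Eventually.of_forall fun z hz =>
              (hf.potential_le_of_mem_ball hA hw.le hAw hz).1)
  -- the mass outside the cone
  set b := A * w ^ 2 / 10 with hb
  have hb0 : 0 < b := by positivity
  have hout : ∫ z in (cone θ w)ᶜ, g z ≤ Real.exp 3 * ((b ^ 2)⁻¹ * E) := by
    have hbi := (integrable_exp_neg_mul_norm hb0).const_mul (Real.exp 3)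
    calc ∫ z in (cone θ w)ᶜ, g z
        ≤ ∫ z in (cone θ w)ᶜ, Real.exp 3 * Real.exp (-(b * ‖z‖)) := by
          refine setIntegral_mono_on hgi.integrableOn hbi.integrableOn hSm.compl fun z hz => ?_
          rw [← Real.exp_add, hg, Real.exp_le_exp]
          have := hf.le_potential_of_notMem_cone hA0 hw.le hz
          rw [← hb] at this
          linarith
      _ ≤ ∫ z, Real.exp 3 * Real.exp (-(b * ‖z‖)) :=
          setIntegral_le_integral hbi (Filter.Eventually.of_forall fun z => by positivity)
      _ = _ := by rw [integral_const_mul, integral_exp_neg_mul_norm hb0]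
  have hcmp : ∫ z in (cone θ w)ᶜ, g z ≤ ∫ z in cone θ w, g z := by
    refine hout.trans (le_trans ?_ hin)
    rw [div_le_iff₀ hv0] at hR2
    have e11 : Real.exp 11 = Real.exp 3 * Real.exp 8 := by rw [← Real.exp_add]; norm_num
    have e8 : Real.exp (-8) * Real.exp 8 = 1 := by rw [← Real.exp_add]; norm_num
    have hkey : Real.exp 3 * ((b ^ 2)⁻¹ * E) =
        (1600 * Real.exp 11 * E) * Real.exp (-8) / (16 * A ^ 2 * w ^ 4) := by
      rw [e11, hb, show 1600 * (Real.exp 3 * Real.exp 8) * E * Real.exp (-8) =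
        1600 * Real.exp 3 * E * (Real.exp (-8) * Real.exp 8) by ring, e8]
      field_simp
      ring
    rw [hkey, div_le_iff₀ (by positivity)]
    calc _ ≤ (A * w ^ 4 * v) * Real.exp (-8) :=
          mul_le_mul_of_nonneg_right hR2 (Real.exp_pos _).le
      _ = _ := by field_simp
  have htot := integral_add_compl hSm hgi
  have hpos : 0 < ∫ z, g z := integral_exp_pos hgi
  rw [gibbs, measureReal_def, tilted_apply_eq_ofReal_integral' _ hSm, ENNReal.toReal_ofReal,
    integral_div, le_div_iff₀ hpos]
  · linarith
  · exact integral_nonneg fun z => div_nonneg (Real.exp_pos _).le hpos.le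

/-! ### The query lower bound -/

/-- The lower bound for every oracle whose answer to a query is determined by the values of the
potential within distance `κ⁻¹` of the query. -/
theorem exists_forall_mul_log_le_of_local :
    ∃ c κ₀ : ℝ, 0 < c ∧ 1 < κ₀ ∧ ∀ κ : ℝ, κ₀ ≤ κ →
      ∀ (R : Type) (oracle : (Plane → ℝ) → Plane → R),
        (∀ (V W : Plane → ℝ) (z : Plane), (∀ w, ‖w - z‖ ≤ κ⁻¹ → V w = W w) →
          oracle V z = oracle W z) →
        ∀ (𝒜 : SamplingAlgorithm.{u} R) (n : ℕ), 𝒜.SamplesWithin oracle κ n (1 / 4) →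
          c * Real.log κ ≤ n := by
  obtain ⟨K, hK1, hK⟩ := exists_bound_deriv_cut
  obtain ⟨R₀, hR1, hR⟩ := exists_half_le_gibbs_cone
  -- This makes the second derivative of the tilt, at most `4ηK`, no larger than `1/8`.
  set η := 1 / (32 * K) with hη
  have hK0 : 0 < K := one_pos.trans_le hK1
  have hη0 : 0 < η := by positivity
  have hη32 : η ≤ 1 / 32 := one_div_le_one_div_of_le (by norm_num) (by linarith)
  have hη4 : η ≤ 1 / 4 := by linarith
  have hηK : 4 * η * K ≤ 1 / 8 := le_of_eq (by rw [hη]; field_simp; norm_num)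
  set L := -Real.log (η / 2) with hL
  have hL0 : 0 < L := neg_pos.2 (Real.log_neg (by positivity) (by linarith))
  set M := 1000 * (256 * R₀) ^ 2 with hM
  have hM1 : 1000 ≤ M := by rw [hM]; nlinarith
  refine ⟨1 / (100 * L), max (M ^ 5) (Real.exp (110 * L)), by positivity,
    lt_max_of_lt_left (one_lt_pow₀ (by linarith) (by norm_num)), ?_⟩
  intro κ hκ R oracle horacle 𝒜 n hA
  have hκM : M ^ 5 ≤ κ := (le_max_left _ _).trans hκ
  have hκ0 : 0 < κ := (pow_pos (by linarith) 5).trans_le hκM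
  have hlog : 110 * L ≤ Real.log κ :=
    (Real.le_log_iff_exp_le hκ0).2 ((le_max_right _ _).trans hκ)
  -- the number of hidden bits
  set J := ⌊Real.log κ / (10 * L)⌋₊ with hJ
  have hJle : (J : ℝ) ≤ Real.log κ / (10 * L) :=
    Nat.floor_le (div_nonneg (by linarith) (by positivity))
  have hJlt : Real.log κ / (10 * L) < J + 1 := Nat.lt_floor_add_one _
  -- `D` is the inverse of the final interval radius. The factor `10` in `J` gives `D ^ 10 ≤ κ`,
  -- leaving room for the smoothness `1000 A² = M D ^ 8`, with the constant `M` paid for by `M ^ 5 ≤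
  -- κ`.
  set D := (η / 2)⁻¹ ^ J with hD
  have hD1 : 1 ≤ D := one_le_pow₀ ((one_le_inv₀ (by positivity)).2 (by linarith))
  have hD0 : 0 < D := one_pos.trans_le hD1
  have hDinv : (η / 2) ^ J = D⁻¹ := by rw [hD, inv_pow, inv_inv]
  have hDκ : D ^ 10 ≤ κ := by
    rw [← Real.log_le_log_iff (pow_pos hD0 _) hκ0, hD, Real.log_pow, Real.log_pow, Real.log_inv,
      ← hL]
    rw [le_div_iff₀ (by positivity)] at hJle
    push_cast
    linarith
  -- aperture and steepness
  set w := (4 * D)⁻¹ with hw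
  set A := 256 * R₀ * D ^ 4 with hAdef
  have hw0 : 0 < w := by positivity
  have hw4 : w ≤ 1 / 4 := by
    rw [hw, one_div]; exact inv_anti₀ (by norm_num) (by linarith)
  have hR0 : 0 < R₀ := one_pos.trans_le hR1
  have hA1 : 1 ≤ A := by
    have := one_le_pow₀ hD1 (n := 4)
    rw [hAdef]; nlinarith
  have hAw : R₀ ≤ A * w ^ 4 := le_of_eq (by rw [hAdef, hw]; field_simp; norm_num)
  have hAκ : 1000 * A ^ 2 ≤ κ := by
    have e : 1000 * A ^ 2 = M * D ^ 8 := by rw [hAdef, hM]; ring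
    rw [e]
    refine le_of_pow_le_pow_left₀ (n := 5) (by norm_num) hκ0.le ?_
    calc (M * D ^ 8) ^ 5 = M ^ 5 * (D ^ 10) ^ 4 := by ring
      _ ≤ κ * κ ^ 4 := by gcongr
      _ = κ ^ 5 := by ring
  -- A ball of radius `κ⁻¹` is too small to see beyond the finest interval, since `A * D` is only of
  -- order `D ^ 5`, at most `√κ` up to a constant.
  have hAδ : 80 * A * κ⁻¹ ≤ (η / 2) ^ J := by
    rw [hDinv, mul_inv_le_iff₀ hκ0, inv_mul_eq_div, le_div_iff₀ hD0]
    refine le_of_pow_le_pow_left₀ (n := 2) (by norm_num) hκ0.le ?_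
    have e : (80 * A * D) ^ 2 = (20480 * R₀) ^ 2 * D ^ 10 := by rw [hAdef]; ring
    have e2 : (20480 * R₀) ^ 2 ≤ M ^ 5 := by
      have : M ≤ M ^ 4 := le_self_pow₀ (by linarith) (by norm_num)
      have : (20480 * R₀) ^ 2 ≤ M * M ^ 1 := by rw [hM]; nlinarith [sq_nonneg R₀]
      nlinarith
    rw [e, sq κ]
    exact mul_le_mul (e2.trans hκM) hDκ (by positivity) hκ0.le
  have hprof : ∀ b, IsProfile (profile η b) (center η b 0 1) := fun b =>
    isProfile_profile hη0 hη4 hK hηK b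
  have hpot : ∀ b, IsPotential κ (potential A (profile η b)) := fun b =>
    (hprof b).isPotential_potential hA1 hAκ
  have hcount := 𝒜.mul_two_pow_le (fun b => oracle (potential A (profile η b))) J
    (fun z => ⟨fun k => bitPath η (z 1 / z 0) k 0 1, fun p x t t' ht _ hx =>
      horacle _ _ z fun u hu => potential_eq_of_bitPath_ne hη0 hη4 p x t t' (hprof _) (hprof _)
        rfl rfl (one_pos.trans_le hA1) (by rwa [ht]) hu hx⟩)
    (fun b => cone (center η b 0 1) w) (fun b => measurableSet_cone _ _)
    (fun b hb b' hb' hne => by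
      refine disjoint_cone (hprof b).abs_le_one hw0 hw4 ?_
      have hl := length_of_mem_bitLists hb
      have := center_separated hη0 hη4 b b' (hl.trans (length_of_mem_bitLists hb').symm) hne 0
        one_pos
      rw [hl, hDinv, mul_one] at this
      refine le_trans ?_ this
      rw [hw, mul_inv]
      have : 0 < D⁻¹ := inv_pos.2 hD0
      linarith)
    -- The value `q = 1/4` is the Gibbs mass `1/2` of the cone minus the accuracy `1/4`.
    n (fun b _ => (hA _ (hpot b)).1) (q := 1 / 4)
    (fun b _ => by
      have hm := (hA _ (hpot b)).1
      have : IsProbabilityMeasure (𝒜.law.map (𝒜.sample (oracle (potential A (profile η b))) n)) :=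
        Measure.isProbabilityMeasure_map hm
      have : IsProbabilityMeasure (gibbs (potential A (profile η b))) :=
        isProbabilityMeasure_tilted
          ((hprof b).integrable_exp_neg_potential (one_pos.trans_le hA1))
      have h1 := sub_le_measureReal_of_tvDist_le (hA _ (hpot b)).2
        (measurableSet_cone (center η b 0 1) w)
      have h2 := hR _ _ w A (hprof b) hw0 (by linarith) hAw
      linarith)
  -- conclusion
  have hnat : 2 * J ≤ 5 * n + 10 := by
    have h43 : ((4 : ℝ) / 3) ^ J ≤ 2 ^ (n + 2) := by
      have e : (2 : ℝ) ^ J = (3 / 2) ^ J * (4 / 3) ^ J := by rw [← mul_pow]; norm_num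
      have hp : (0 : ℝ) < (3 / 2) ^ J := by positivity
      refine le_of_mul_le_mul_left ?_ hp
      rw [← e, pow_add]
      linarith
    -- The inequality `(4/3) ^ 5 ≥ 4` turns the count into one between powers of two.
    refine (pow_le_pow_iff_right₀ (one_lt_two : (1 : ℝ) < 2)).1 ?_
    calc (2 : ℝ) ^ (2 * J) = 4 ^ J := by rw [pow_mul]; norm_num
      _ ≤ ((4 / 3) ^ 5) ^ J := pow_le_pow_left₀ (by norm_num) (by norm_num) J
      _ = ((4 / 3) ^ J) ^ 5 := by rw [← pow_mul, ← pow_mul, mul_comm]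
      _ ≤ (2 ^ (n + 2)) ^ 5 := pow_le_pow_left₀ (by positivity) h43 5
      _ = 2 ^ (5 * n + 10) := by rw [← pow_mul]; congr 1; ring
  have hnat' : 2 * (J : ℝ) ≤ 5 * n + 10 := by exact_mod_cast hnat
  -- The threshold absorbs the additive losses: the rounding of `J` and the constant `10` in `hnat`.
  have hq : 11 ≤ Real.log κ / (10 * L) := by
    rw [le_div_iff₀ (by positivity)]; linarith
  have e : 1 / (100 * L) * Real.log κ = Real.log κ / (10 * L) / 10 := by
    field_simp; ring
  rw [e]
  linarith

end

end LogConcaveSampling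

theorem mainTheorem1 :
    ∃ ε₀ c κ₀ C : ℝ, 0 < ε₀ ∧ 0 < c ∧ 1 < κ₀ ∧ 0 < C ∧
      ∀ κ : ℝ, κ₀ ≤ κ →
        (∀ (A : LogConcaveSampling.SamplingAlgorithm.{u} (ℝ × LogConcaveSampling.Plane)) (n : ℕ),
          A.SamplesWithin LogConcaveSampling.firstOrderOracle κ n ε₀ →
            c * Real.log κ ≤ (n : ℝ)) ∧
        (∀ (A : LogConcaveSampling.SamplingAlgorithm.{u}
              (Metric.closedBall (0 : LogConcaveSampling.Plane) (κ ^ (-C)) → ℝ)) (n : ℕ),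
          A.SamplesWithin (LogConcaveSampling.extendedOracle (κ ^ (-C))) κ n ε₀ →
            c * Real.log κ ≤ (n : ℝ)) := by
  obtain ⟨c, κ₀, hc, hκ₀, h⟩ := LogConcaveSampling.exists_forall_mul_log_le_of_local.{u}
  -- The exponent `C = 1` suffices, since the local bound already allows answers determined within
  -- distance `κ⁻¹`.
  refine ⟨1 / 4, c, κ₀, 1, by norm_num, hc, hκ₀, one_pos, fun κ hκ => ⟨?_, ?_⟩⟩
  · have hpos : 0 < κ := by linarith
    exact h κ hκ _ LogConcaveSampling.firstOrderOracle fun V W z hVW =>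
      LogConcaveSampling.firstOrderOracle_congr (inv_pos.2 hpos) hVW
  · refine h κ hκ _ (LogConcaveSampling.extendedOracle (κ ^ (-(1 : ℝ)))) fun V W z hVW =>
      LogConcaveSampling.extendedOracle_congr fun w hw => hVW w ?_
    rwa [Real.rpow_neg_one] at hw
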